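/- Let $0<s<1$, $0<p,q<\infty$ and $c_d>0$. There is a constant $C>0$, depending only on $s,p,q,c_d$, such that the following holds. Let $(X,d)$ be a metric space with a Borel regular (outer) measure $\mu$ such that $0<\mu(B(x,r))<\infty$ and $\mu(B(x,2r))\le c_d\,\mu(B(x,r))$ for all $x\in X$, $r>0$, where $B(x,r)=\{y\in X: d(y,x)<r\}$. Then, for every compact set $K\subset X$, $$C^{-1}\inf_{u\in\tilde{\mathcal A}(K)}\|u\|_{N^s_{p,q}(X)}^p\le C^s_{p,q}(K)\le C\inf_{u\in\tilde{\mathcal A}(K)}\|u\|_{N^s_{p,q}(X)}^p .$$ Here $L^0(X)$ is the set of measurable, almost everywhere finite functions $u:X\to[-\infty,\infty]$. A sequence $(g_k)_{k\in\mathbb Z}$ of nonnegative measurable functions is a fractional $s$-gradient of $u\in L^0(X)$, written $(g_k)\in\mathbb D^s(u)$, if there is a set $E$ with $\mu(E)=0$ such that $|u(x)-u(y)|\le d(x,y)^s(g_k(x)+g_k(y))$ for all $k\in\mathbb Z$ and all $x,y\in X\setminus E$ with $2^{-k-1}\le d(x,y)<2^{-k}$. We put $$\|u\|_{\dot N^s_{p,q}(X)}=\inf_{(g_k)\in\mathbb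 D^s(u)}\Big(\sum_{k\in\mathbb Z}\|g_k\|_{L^p(X)}^q\Big)^{1/q},\qquad \|u\|_{N^s_{p,q}(X)}=\|u\|_{L^p(X)}+\|u\|_{\dot N^s_{p,q}(X)},$$ and $N^s_{p,q}(X)$ is the set of $u\in L^0(X)$ for which $\|u\|_{N^s_{p,q}(X)}<\infty$. For $E\subset X$, $\mathcal A(E)$ is the set of $u\in N^s_{p,q}(X)$ with $u\ge1$ in a neighbourhood of $E$ (an open set containing $E$), $\tilde{\mathcal A}(E)$ is the set of $u\in\mathcal A(E)$ that are (real-valued and) locally Lipschitz, that is, Lipschitz in some neighbourhood of each point of $X$, and the Besov capacity is $C^s_{p,q}(E)=\inf_{u\in\mathcal A(E)}\|u\|_{N^s_{p,q}(X)}^p$. -/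

import Mathlib

open MeasureTheory
open scoped ENNReal NNReal

noncomputable section

namespace HajlaszBesov

/-- `μ` is a doubling measure with doubling constant `cd`, and every ball has positive and
finite measure. -/
structure IsDoubling {X : Type*} [MetricSpace X] [MeasurableSpace X]
    (μ : Measure X) (cd : ℝ≥0) : Prop where
  ball_pos : ∀ (x : X) (r : ℝ), 0 < r → 0 < μ (Metric.ball x r)
  ball_lt_top : ∀ (x : X) (r : ℝ), 0 < r → μ (Metric.ball x r) < ∞
  doubling : ∀ (x : X) (r : ℝ), 0 < r →
    μ (Metric.ball x (2 * r)) ≤ (cd : ℝ≥0∞) * μ (Metric.ball x r)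

section

variable {X : Type*} [MetricSpace X] [MeasurableSpace X]

/-- The class `L⁰(X)` of extended-real-valued functions that are measurable with respect to (the
completion of) `μ` and finite almost everywhere. -/
def MemL0 (μ : Measure X) (u : X → EReal) : Prop :=
  AEMeasurable u μ ∧ ∀ᵐ x ∂μ, u x ≠ ⊥ ∧ u x ≠ ⊤

/-- The (quasi-)norm `‖f‖_{L^p(X)}`, `0 < p < ∞`, of a nonnegative function. -/
def scalarNorm (μ : Measure X) (p : ℝ) (f : X → ℝ≥0∞) : ℝ≥0∞ :=
  (∫⁻ x, f x ^ p ∂μ) ^ (1 / p)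

/-- The mixed (quasi-)norm `‖(g_k)‖_{l^q(L^p(X))}`, `0 < p, q < ∞`. -/
def mixedNorm (μ : Measure X) (p q : ℝ) (g : ℤ → X → ℝ≥0∞) : ℝ≥0∞ :=
  (∑' k : ℤ, scalarNorm μ p (g k) ^ q) ^ (1 / q)

/-- `(g_k)` is a fractional `s`-gradient of `u`. The exceptional null set `E` is taken to contain
the null set where `u` is infinite, so that `u x - u y` is a difference of real numbers. -/
def IsFractionalGradient (μ : Measure X) (s : ℝ) (u : X → EReal) (g : ℤ → X → ℝ≥0∞) : Prop :=
  (∀ k, AEMeasurable (g k) μ) ∧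
    ∃ E : Set X, μ E = 0 ∧ (∀ x ∉ E, u x ≠ ⊥ ∧ u x ≠ ⊤) ∧
      ∀ k : ℤ, ∀ x ∉ E, ∀ y ∉ E,
        (2 : ℝ) ^ (-k - 1) ≤ dist x y → dist x y < (2 : ℝ) ^ (-k) →
          ENNReal.ofReal |(u x).toReal - (u y).toReal|
            ≤ ENNReal.ofReal (dist x y ^ s) * (g k x + g k y)

/-- The homogeneous Hajłasz–Besov (semi)norm: the infimum of `‖(g_k)‖_{l^q(L^p(X))}` over all
fractional `s`-gradients of `u`. -/
def homNorm (μ : Measure X) (s p q : ℝ) (u : X → EReal) : ℝ≥0∞ :=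
  ⨅ (g : ℤ → X → ℝ≥0∞) (_ : IsFractionalGradient μ s u g), mixedNorm μ p q g

/-- The Hajłasz–Besov (quasi-)norm `‖u‖_{L^p(X)}` plus the homogeneous (semi)norm. -/
def besovNorm (μ : Measure X) (s p q : ℝ) (u : X → EReal) : ℝ≥0∞ :=
  scalarNorm μ p (fun x => (u x).abs) + homNorm μ s p q u

/-- The Hajłasz–Besov space `N^s_{p,q}(X)`. -/
def besovSpace (μ : Measure X) (s p q : ℝ) : Set (X → EReal) :=
  {u | MemL0 μ u ∧ scalarNorm μ p (fun x => (u x).abs) < ∞ ∧ homNorm μ s p q u < ∞}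

/-- The admissible functions for the capacity of `E`: functions in `N^s_{p,q}(X)` that are at
least `1` in a neighbourhood of `E`. -/
def admissible (μ : Measure X) (s p q : ℝ) (E : Set X) : Set (X → EReal) :=
  {u | u ∈ besovSpace μ s p q ∧ ∃ U : Set X, IsOpen U ∧ E ⊆ U ∧ ∀ x ∈ U, 1 ≤ u x}

/-- The admissible functions that are (real-valued and) locally Lipschitz. -/
def lipAdmissible (μ : Measure X) (s p q : ℝ) (E : Set X) : Set (X → EReal) :=
  {u | u ∈ admissible μ s p q E ∧
    ∃ f : X → ℝ, LocallyLipschitz f ∧ ∀ x, u x = (f x : EReal)}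

/-- The Besov capacity `C^s_{p,q}(E)`. -/
def besovCapacity (μ : Measure X) (s p q : ℝ) (E : Set X) : ℝ≥0∞ :=
  ⨅ u ∈ admissible μ s p q E, besovNorm μ s p q u ^ p

/-- The infimum of `‖u‖^p` over the locally Lipschitz admissible functions only. -/
def lipCapacity (μ : Measure X) (s p q : ℝ) (E : Set X) : ℝ≥0∞ :=
  ⨅ u ∈ lipAdmissible μ s p q E, besovNorm μ s p q u ^ p

end

end HajlaszBesov

end

/-! One inequality is immediate, since locally Lipschitz admissible functions are admissible. For
the other, each admissible `u` is replaced by a locally Lipschitz admissible function whose norm is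
larger by at most a factor depending only on `s, p, q, cd`. No approximation is needed, only
boundedness uniform in the scale `r = 2 ^ (-m)`.

Truncate `u` to `[0, 1]`, take the median over `B(z, r)`, and average over `1 ≤ t ≤ 2` the supremum
of the medians over `B(x, r t)`. Medians make sense for every `p > 0`, where integral averages of
`u` may be uncontrolled. The average over `t` turns local suprema into a `1 / r`-Lipschitz function
without a partition of unity. Compactness of `K` makes `r` small enough that all medians near `K`
are at least `1`; the smoothing dominates the medians.

For the seminorm, a difference of medians is bounded by differences of the function at points where
the gradient is below its `L^p` mean on a ball of radius `8 r`. Well above scale `r`, the given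
gradient at neighbouring scales suffices. At distances `d < 16 r`, the Lipschitz factor `d / r = d ^
s * (d ^ (1 - s) / r)` gives weights whose `l^q` norm converges because `s < 1`, while the finer
gradients are summed using `s > 0` (`smoothingGradient_spec`, `mixedNorm_smoothingGradient_le`).
Local `L^p` means are bounded on `L^p` by Tonelli and doubling, so no maximal theorem is used. -/

namespace HajlaszBesov

/-! ### Quasi-norms for all positive exponents. -/

section Norms

variable {α : Type*} [MeasurableSpace α] {ν : Measure α} {p : ℝ}

theorem scalarNorm_mono_ae (hp : 0 < p) {f g : α → ℝ≥0∞} (h : ∀ᵐ x ∂ν, f x ≤ g x) :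
    scalarNorm ν p f ≤ scalarNorm ν p g := by
  unfold scalarNorm
  gcongr ?_ ^ _
  exact lintegral_mono_ae (h.mono fun x hx => ENNReal.rpow_le_rpow hx hp.le)

theorem scalarNorm_mono (hp : 0 < p) {f g : α → ℝ≥0∞} (h : ∀ x, f x ≤ g x) :
    scalarNorm ν p f ≤ scalarNorm ν p g :=
  scalarNorm_mono_ae hp (.of_forall h)

theorem scalarNorm_congr_ae {f g : α → ℝ≥0∞} (h : f =ᵐ[ν] g) :
    scalarNorm ν p f = scalarNorm ν p g := by
  unfold scalarNorm
  rw [lintegral_congr_ae (h.mono fun x hx => by rw [hx])]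

theorem scalarNorm_rpow (hp : 0 < p) (f : α → ℝ≥0∞) :
    scalarNorm ν p f ^ p = ∫⁻ x, f x ^ p ∂ν := by
  unfold scalarNorm
  rw [one_div, ENNReal.rpow_inv_rpow hp.ne']

theorem scalarNorm_le_iff (hp : 0 < p) {f : α → ℝ≥0∞} {c : ℝ≥0∞} :
    scalarNorm ν p f ≤ c ↔ ∫⁻ x, f x ^ p ∂ν ≤ c ^ p := by
  rw [← scalarNorm_rpow hp, ENNReal.rpow_le_rpow_iff hp]

theorem scalarNorm_const_mul (hp : 0 < p) {c : ℝ≥0∞} (hc : c ≠ ∞) (f : α → ℝ≥0∞) :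
    scalarNorm ν p (fun x => c * f x) = c * scalarNorm ν p f := by
  unfold scalarNorm
  simp_rw [ENNReal.mul_rpow_of_nonneg _ _ hp.le]
  rw [lintegral_const_mul' _ _ (ENNReal.rpow_ne_top_of_nonneg hp.le hc),
    ENNReal.mul_rpow_of_nonneg _ _ (by positivity), one_div, ENNReal.rpow_rpow_inv hp.ne']

theorem scalarNorm_mul_const (hp : 0 < p) {c : ℝ≥0∞} (hc : c ≠ ∞) (f : α → ℝ≥0∞) :
    scalarNorm ν p (fun x => f x * c) = scalarNorm ν p f * c := by
  simp_rw [mul_comm _ c]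
  exact scalarNorm_const_mul hp hc f

theorem ennreal_add_rpow_le (hp : 0 < p) (a b : ℝ≥0∞) :
    (a + b) ^ p ≤ 2 ^ p * (a ^ p + b ^ p) := by
  rcases le_total a b with h | h
  · calc (a + b) ^ p ≤ (2 * b) ^ p := by
          gcongr; rw [two_mul]; gcongr
      _ = 2 ^ p * b ^ p := ENNReal.mul_rpow_of_nonneg _ _ hp.le
      _ ≤ _ := by gcongr; exact le_add_self
  · calc (a + b) ^ p ≤ (2 * a) ^ p := by
          gcongr; rw [two_mul]; gcongr
      _ = 2 ^ p * a ^ p := ENNReal.mul_rpow_of_nonneg _ _ hp.le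
      _ ≤ _ := by gcongr; exact le_self_add

theorem ennreal_inv_le_mul_inv {a b c : ℝ≥0∞} (hc : c ≠ ∞) (hb : b ≠ 0) (h : b ≤ c * a) :
    a⁻¹ ≤ c * b⁻¹ := by
  have hc0 : c ≠ 0 := by
    rintro rfl
    exact hb (le_antisymm (by simpa using h) zero_le)
  calc a⁻¹ = c * (c * a)⁻¹ := by
        rw [ENNReal.mul_inv (.inl hc0) (.inl hc), ← mul_assoc, ENNReal.mul_inv_cancel hc0 hc,
          one_mul]
    _ ≤ c * b⁻¹ := by gcongr

/-- The constant in the quasi-triangle inequality for `scalarNorm`. -/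
noncomputable def quasiConst (p : ℝ) : ℝ≥0∞ := 2 * 2 ^ (1 / p)

theorem quasiConst_ne_top (hp : 0 < p) : quasiConst p ≠ ∞ := by
  unfold quasiConst
  have : (2 : ℝ≥0∞) ^ (1 / p) ≠ ∞ :=
    ENNReal.rpow_ne_top_of_nonneg (by positivity) ENNReal.ofNat_ne_top
  finiteness

theorem scalarNorm_add_le (hp : 0 < p) {f g : α → ℝ≥0∞} (hf : AEMeasurable f ν) :
    scalarNorm ν p (fun x => f x + g x)
      ≤ quasiConst p * (scalarNorm ν p f + scalarNorm ν p g) := by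
  have hp' : 0 ≤ 1 / p := by positivity
  have h1 : ∫⁻ x, (f x + g x) ^ p ∂ν ≤ 2 ^ p * (∫⁻ x, f x ^ p ∂ν + ∫⁻ x, g x ^ p ∂ν) := by
    rw [← lintegral_add_left' (hf.pow_const p), ← lintegral_const_mul' _ _
      (ENNReal.rpow_ne_top_of_nonneg hp.le ENNReal.ofNat_ne_top)]
    exact lintegral_mono fun x => ennreal_add_rpow_le hp _ _
  have h2 := ENNReal.rpow_le_rpow h1 hp'
  have hp1 : 0 < 1 / p := by positivity
  calc scalarNorm ν p (fun x => f x + g x)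
      ≤ (2 ^ p * (∫⁻ x, f x ^ p ∂ν + ∫⁻ x, g x ^ p ∂ν)) ^ (1 / p) := h2
    _ = 2 * (∫⁻ x, f x ^ p ∂ν + ∫⁻ x, g x ^ p ∂ν) ^ (1 / p) := by
        rw [ENNReal.mul_rpow_of_nonneg _ _ hp', one_div, ENNReal.rpow_rpow_inv hp.ne']
    _ ≤ 2 * (2 ^ (1 / p) * (scalarNorm ν p f + scalarNorm ν p g)) := by
        gcongr
        exact ennreal_add_rpow_le hp1 _ _
    _ ≤ quasiConst p * (scalarNorm ν p f + scalarNorm ν p g) := by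
        unfold quasiConst
        rw [← mul_assoc]

/-- With counting measure on the scales, the `scalarNorm` lemmas apply to the outer `l^q` norm too.
-/
theorem mixedNorm_eq (p q : ℝ) (g : ℤ → α → ℝ≥0∞) :
    mixedNorm ν p q g = scalarNorm Measure.count q (fun k : ℤ => scalarNorm ν p (g k)) := by
  rw [mixedNorm, scalarNorm, lintegral_count]

theorem scalarNorm_le_mixedNorm {q : ℝ} (hq : 0 < q) (g : ℤ → α → ℝ≥0∞) (k : ℤ) :
    scalarNorm ν p (g k) ≤ mixedNorm ν p q g := by
  have := ENNReal.rpow_le_rpow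
    (ENNReal.le_tsum (f := fun k : ℤ => scalarNorm ν p (g k) ^ q) k)
    (show 0 ≤ 1 / q by positivity)
  rwa [one_div, ENNReal.rpow_rpow_inv hq.ne', ← one_div] at this

theorem mixedNorm_add_le {q : ℝ} (hp : 0 < p) (hq : 0 < q) {f g : ℤ → α → ℝ≥0∞}
    (hf : ∀ k, AEMeasurable (f k) ν) :
    mixedNorm ν p q (fun k x => f k x + g k x)
      ≤ quasiConst p * quasiConst q * (mixedNorm ν p q f + mixedNorm ν p q g) := by
  simp_rw [mixedNorm_eq]
  calc _ ≤ scalarNorm Measure.count q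
        (fun k : ℤ => quasiConst p * (scalarNorm ν p (f k) + scalarNorm ν p (g k))) :=
        scalarNorm_mono hq fun k => scalarNorm_add_le hp (hf k)
    _ ≤ _ := by
        rw [scalarNorm_const_mul hq (quasiConst_ne_top hp), mul_assoc]
        gcongr
        exact scalarNorm_add_le hq (measurable_of_countable _).aemeasurable

theorem mixedNorm_shift {q : ℝ} (g : ℤ → α → ℝ≥0∞) (j : ℤ) :
    mixedNorm ν p q (fun k => g (k + j)) = mixedNorm ν p q g := by
  unfold mixedNorm
  rw [← (Equiv.addRight j).tsum_eq (fun k : ℤ => scalarNorm ν p (g k) ^ q)]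
  rfl

end Norms

/-! ### Topological consequences of doubling. -/

section Doubling

variable {X : Type*} [MetricSpace X] [MeasurableSpace X] {μ : Measure X} {cd : ℝ≥0}

theorem IsDoubling.doubling_pow (h : IsDoubling μ cd) (x : X) {r : ℝ} (hr : 0 < r) (n : ℕ) :
    μ (Metric.ball x (2 ^ n * r)) ≤ (cd : ℝ≥0∞) ^ n * μ (Metric.ball x r) := by
  induction n with
  | zero => simp
  | succ n ih =>
    calc μ (Metric.ball x (2 ^ (n + 1) * r)) = μ (Metric.ball x (2 * (2 ^ n * r))) := by
          rw [pow_succ]; ring_nf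
      _ ≤ cd * μ (Metric.ball x (2 ^ n * r)) := h.doubling x _ (by positivity)
      _ ≤ cd * ((cd : ℝ≥0∞) ^ n * μ (Metric.ball x r)) := by gcongr
      _ = _ := by rw [pow_succ]; ring

theorem IsDoubling.sigmaFinite [OpensMeasurableSpace X] (h : IsDoubling μ cd) :
    SigmaFinite μ := by
  rcases isEmpty_or_nonempty X with hX | ⟨⟨x⟩⟩
  · rw [Measure.eq_zero_of_isEmpty μ]; infer_instance
  · refine ⟨⟨⟨fun n : ℕ => Metric.ball x (n + 1), fun _ => trivial,
      fun n => h.ball_lt_top x _ (by positivity), ?_⟩⟩⟩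
    refine Set.eq_univ_of_forall fun y => Set.mem_iUnion.2 ?_
    obtain ⟨n, hn⟩ := exists_nat_gt (dist y x)
    exact ⟨n, Metric.mem_ball.2 (by linarith)⟩

/-- Disjoint balls of positive measure are countable in number in a σ-finite space, and a Vitali
selection makes their centres an `ε`-net. Separability is needed to measure `{dist < R}` in the
product σ-algebra. -/
theorem IsDoubling.secondCountableTopology [OpensMeasurableSpace X] (h : IsDoubling μ cd) :
    SecondCountableTopology X := by
  have := h.sigmaFinite
  refine Metric.secondCountable_of_almost_dense_set fun ε hε => ?_
  obtain ⟨u, -, hd, hc⟩ := Vitali.exists_disjoint_subfamily_covering_enlargement_closedBall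
    (Set.univ : Set X) id (fun _ => ε / 5) (ε / 5) (fun _ _ => le_rfl) 5 (by norm_num)
  refine ⟨u, ?_, fun x => ?_⟩
  · have := Measure.countable_meas_pos_of_disjoint_iUnion (μ := μ)
      (As := fun a : u => Metric.closedBall (a : X) (ε / 5))
      (fun a => Metric.isClosed_closedBall.measurableSet) (fun a b hab =>
        hd a.2 b.2 (fun h => hab (Subtype.ext h)))
    have h2 : {i : u | 0 < μ (Metric.closedBall (i : X) (ε / 5))} = Set.univ :=
      Set.eq_univ_of_forall fun i => (h.ball_pos i (ε / 5) (by positivity)).trans_le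
        (measure_mono Metric.ball_subset_closedBall)
    rw [h2, Set.countable_univ_iff] at this
    exact Set.countable_coe_iff.1 this
  · obtain ⟨b, hb, hsub⟩ := hc x trivial
    refine ⟨b, hb, ?_⟩
    have := hsub (Metric.mem_closedBall_self (by positivity))
    rw [Metric.mem_closedBall] at this
    simp only [id] at this
    linarith

end Doubling

/-! ### Ball averages on `L^1`. -/

/-- The average of `f` over the ball `B(x, R)`. -/
noncomputable def ballAverage {X : Type*} [MetricSpace X] [MeasurableSpace X] (μ : Measure X)
    (R : ℝ) (f : X → ℝ≥0∞) (x : X) : ℝ≥0∞ :=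
  (μ (Metric.ball x R))⁻¹ * ∫⁻ y in Metric.ball x R, f y ∂μ

section Average

variable {X : Type*} [MetricSpace X] [MeasurableSpace X] [BorelSpace X] {μ : Measure X}
  {cd : ℝ≥0} {R p : ℝ} {f : X → ℝ≥0∞}

theorem measurableSet_dist_lt [SecondCountableTopology X] (R : ℝ) :
    MeasurableSet {z : X × X | dist z.2 z.1 < R} :=
  measurableSet_lt (measurable_snd.dist measurable_fst) measurable_const

theorem setLIntegral_ball_eq (f : X → ℝ≥0∞) (x : X) :
    ∫⁻ y in Metric.ball x R, f y ∂μ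
      = ∫⁻ y, {z : X × X | dist z.2 z.1 < R}.indicator (fun z => f z.2) (x, y) ∂μ := by
  rw [← lintegral_indicator Metric.isOpen_ball.measurableSet]
  rfl

theorem measurable_setLIntegral_ball [SecondCountableTopology X] [SFinite μ]
    (hf : Measurable f) : Measurable fun x => ∫⁻ y in Metric.ball x R, f y ∂μ := by
  simp_rw [setLIntegral_ball_eq]
  exact Measurable.lintegral_prod_right'
    ((hf.comp measurable_snd).indicator (measurableSet_dist_lt R))

theorem measurable_measure_ball [SecondCountableTopology X] [SFinite μ] :
    Measurable fun x => μ (Metric.ball x R) := by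
  simpa using measurable_setLIntegral_ball (μ := μ) (R := R) (f := fun _ => 1) measurable_const

theorem measurable_ballAverage (h : IsDoubling μ cd) (hf : Measurable f) :
    Measurable (ballAverage μ R f) := by
  have := h.sigmaFinite
  have := h.secondCountableTopology
  exact measurable_measure_ball.inv.mul (measurable_setLIntegral_ball hf)

/-- After Tonelli, `y` receives the integral of `1 / μ(B(x, R))` over `x ∈ B(y, R)`. There `B(y, R)
⊆ B(x, 2R)`, so this is at most `cd`. -/
theorem lintegral_ballAverage_le (h : IsDoubling μ cd) (hR : 0 < R) (hf : Measurable f) :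
    ∫⁻ x, ballAverage μ R f x ∂μ ≤ cd * ∫⁻ x, f x ∂μ := by
  have := h.sigmaFinite
  have := h.secondCountableTopology
  have hm : Measurable fun x => (μ (Metric.ball x R))⁻¹ := measurable_measure_ball.inv
  let F : X × X → ℝ≥0∞ :=
    {z : X × X | dist z.2 z.1 < R}.indicator fun z => (μ (Metric.ball z.1 R))⁻¹ * f z.2
  have hF : Measurable F :=
    ((hm.comp measurable_fst).mul (hf.comp measurable_snd)).indicator (measurableSet_dist_lt R)
  calc ∫⁻ x, ballAverage μ R f x ∂μ = ∫⁻ x, ∫⁻ y, F (x, y) ∂μ ∂μ := by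
        refine lintegral_congr fun x => ?_
        have hi : Measurable fun y =>
            {z : X × X | dist z.2 z.1 < R}.indicator (fun z => f z.2) (x, y) :=
          ((hf.comp measurable_snd).indicator (measurableSet_dist_lt R)).comp
            measurable_prodMk_left
        rw [ballAverage, setLIntegral_ball_eq, ← lintegral_const_mul _ hi]
        refine lintegral_congr fun y => ?_
        by_cases hxy : dist y x < R <;> simp [F, Set.indicator, hxy]
    _ = ∫⁻ y, ∫⁻ x, F (x, y) ∂μ ∂μ :=
        lintegral_lintegral_swap (f := fun x y => F (x, y)) hF.aemeasurable
    _ ≤ ∫⁻ y, cd * f y ∂μ := by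
        refine lintegral_mono fun y => ?_
        have h1 : ∀ x, F (x, y) ≤ (Metric.ball y R).indicator
            (fun _ => cd * (μ (Metric.ball y R))⁻¹ * f y) x := by
          intro x
          by_cases hxy : dist y x < R
          · have hx : x ∈ Metric.ball y R := by rwa [Metric.mem_ball, dist_comm]
            simp only [F, Set.indicator, Set.mem_ofPred_eq, hxy, hx, if_true]
            gcongr
            have h2 : μ (Metric.ball y R) ≤ cd * μ (Metric.ball x R) :=
              (measure_mono (Metric.ball_subset_ball' (by linarith))).trans (h.doubling x R hR)
            exact ennreal_inv_le_mul_inv ENNReal.coe_ne_top (h.ball_pos y R hR).ne' h2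
          · simp [F, Set.indicator, hxy]
        calc ∫⁻ x, F (x, y) ∂μ ≤ _ := lintegral_mono h1
          _ = cd * (μ (Metric.ball y R))⁻¹ * f y * μ (Metric.ball y R) := by
              rw [lintegral_indicator_const Metric.isOpen_ball.measurableSet]
          _ = cd * f y * ((μ (Metric.ball y R))⁻¹ * μ (Metric.ball y R)) := by ring
          _ = cd * f y := by
              rw [ENNReal.inv_mul_cancel (h.ball_pos y R hR).ne' (h.ball_lt_top y R hR).ne,
                mul_one]
    _ = cd * ∫⁻ x, f x ∂μ := lintegral_const_mul _ hf

end Average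

/-! ### Local `L^p` means and points of good value. -/

/-- The constant normalising `averageOp`. -/
noncomputable def averageConst (cd : ℝ≥0) : ℝ≥0∞ := 2 * (cd : ℝ≥0∞) ^ 4

/-- A multiple of the `L^p` mean of `f` over the ball `B(x, 8 r)`. -/
noncomputable def averageOp {X : Type*} [MetricSpace X] [MeasurableSpace X] (μ : Measure X)
    (cd : ℝ≥0) (p r : ℝ) (f : X → ℝ≥0∞) (x : X) : ℝ≥0∞ :=
  (averageConst cd * ballAverage μ (8 * r) (fun y => f y ^ p) x) ^ (1 / p)

section AverageOp

variable {X : Type*} [MetricSpace X] [MeasurableSpace X] {μ : Measure X}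
  {cd : ℝ≥0} {r p : ℝ} {f : X → ℝ≥0∞}

theorem averageConst_ne_top (cd : ℝ≥0) : averageConst cd ≠ ∞ := by
  unfold averageConst; finiteness

theorem measurable_averageOp [BorelSpace X] (h : IsDoubling μ cd) (hf : Measurable f) :
    Measurable (averageOp μ cd p r f) :=
  ((measurable_ballAverage h (hf.pow_const p)).const_mul _).pow_const _

/-- The bound for `averageOp` on `L^p`. -/
noncomputable def averageBound (cd : ℝ≥0) (p : ℝ) : ℝ≥0∞ := (averageConst cd * cd) ^ (1 / p)

theorem averageBound_ne_top (cd : ℝ≥0) (hp : 0 < p) : averageBound cd p ≠ ∞ :=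
  ENNReal.rpow_ne_top_of_nonneg (by positivity)
    (ENNReal.mul_ne_top (averageConst_ne_top cd) ENNReal.coe_ne_top)

theorem scalarNorm_averageOp_le [BorelSpace X] (h : IsDoubling μ cd) (hp : 0 < p) (hr : 0 < r)
    (hf : Measurable f) :
    scalarNorm μ p (averageOp μ cd p r f) ≤ averageBound cd p * scalarNorm μ p f := by
  rw [scalarNorm_le_iff hp, ENNReal.mul_rpow_of_nonneg _ _ hp.le, scalarNorm_rpow hp]
  simp only [averageOp, averageBound, one_div, ENNReal.rpow_inv_rpow hp.ne']
  rw [lintegral_const_mul _ (measurable_ballAverage h (hf.pow_const p)), mul_assoc]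
  gcongr
  exact lintegral_ballAverage_le h (by positivity) (hf.pow_const p)

/-- On any subset of a ball that carries half of its mass, `f` is somewhere dominated by its
`L^p` mean over a larger ball. -/
theorem exists_le_averageOp (h : IsDoubling μ cd) (hp : 0 < p) (hr : 0 < r)
    (hf : Measurable f) {x z : X} (hz : dist z x < 3 * r) {A E : Set X}
    (hA : A ⊆ Metric.ball z r) (hA2 : μ (Metric.ball z r) ≤ 2 * μ A) (hE : μ E = 0) :
    ∃ y ∈ A, y ∉ E ∧ f y ≤ averageOp μ cd p r f x := by
  have hb0 := h.ball_pos z r hr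
  have hbt := h.ball_lt_top z r hr
  have hμ : μ (A \ E) = μ A := measure_sdiff_null hE
  have hA0 : μ A ≠ 0 := by
    intro h0
    rw [h0, mul_zero] at hA2
    exact hb0.ne' (le_antisymm hA2 zero_le)
  have hAt : μ A ≠ ∞ := ((measure_mono hA).trans_lt hbt).ne
  -- A function is at most its mean on a set of positive measure. Measurability of `A` is not
  -- needed.
  have key := measure_le_setLAverage_pos (μ := μ) (s := A \ E) (f := fun y => f y ^ p)
    (by rwa [hμ]) (by rwa [hμ]) (hf.pow_const p).aemeasurable
  obtain ⟨y, ⟨hyA, hyE⟩, hy⟩ := nonempty_of_measure_ne_zero key.ne'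
  refine ⟨y, hyA, hyE, ?_⟩
  rw [averageOp, one_div, ENNReal.le_rpow_inv_iff hp]
  refine hy.trans ?_
  rw [setLAverage_eq, hμ, ENNReal.div_eq_inv_mul, ballAverage, ← mul_assoc]
  have hsub : A \ E ⊆ Metric.ball x (8 * r) :=
    Set.sdiff_subset.trans (hA.trans (Metric.ball_subset_ball' (by linarith)))
  refine mul_le_mul' ?_ (lintegral_mono_set hsub)
  -- `B(x, 8r) ⊆ B(z, 16r)` costs four doublings and the half mass of `A` costs a factor `2`, whence
  -- `averageConst`.
  have hbig : μ (Metric.ball x (8 * r)) ≤ averageConst cd * μ A := by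
    calc μ (Metric.ball x (8 * r)) ≤ μ (Metric.ball z (2 ^ 4 * r)) :=
          measure_mono (Metric.ball_subset_ball' (by rw [dist_comm]; linarith))
      _ ≤ (cd : ℝ≥0∞) ^ 4 * μ (Metric.ball z r) := h.doubling_pow z hr 4
      _ ≤ (cd : ℝ≥0∞) ^ 4 * (2 * μ A) := by gcongr
      _ = _ := by rw [averageConst]; ring
  exact ennreal_inv_le_mul_inv (averageConst_ne_top cd) (h.ball_pos x _ (by positivity)).ne' hbig

end AverageOp

/-! ### Medians over balls. -/

section Median

variable {X : Type*} [MetricSpace X] [MeasurableSpace X]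

/-- The levels that `f` reaches on at least half of the ball `B(z, r)`. -/
def halfLevels (μ : Measure X) (f : X → ℝ) (r : ℝ) (z : X) : Set ℝ :=
  {l | μ (Metric.ball z r) ≤ 2 * μ (Metric.ball z r ∩ {y | l ≤ f y})}

/-- The (largest) median of `f` over the ball `B(z, r)`. -/
noncomputable def median (μ : Measure X) (f : X → ℝ) (r : ℝ) (z : X) : ℝ :=
  sSup (halfLevels μ f r z)

variable {μ : Measure X} {cd : ℝ≥0} {f : X → ℝ} {r : ℝ}

theorem mem_halfLevels_of_forall_le {l : ℝ} {z : X} (h : ∀ y ∈ Metric.ball z r, l ≤ f y) :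
    l ∈ halfLevels μ f r z := by
  have : Metric.ball z r ∩ {y | l ≤ f y} = Metric.ball z r :=
    Set.inter_eq_left.2 fun y hy => h y hy
  simp only [halfLevels, Set.mem_ofPred_eq, this, two_mul]
  exact le_self_add

theorem le_one_of_mem_halfLevels (h : IsDoubling μ cd) (hr : 0 < r) (h1 : ∀ x, f x ≤ 1)
    {l : ℝ} {z : X} (hl : l ∈ halfLevels μ f r z) : l ≤ 1 := by
  by_contra! hlt
  have : Metric.ball z r ∩ {y | l ≤ f y} = ∅ :=
    Set.eq_empty_of_forall_notMem fun y hy =>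
      (lt_irrefl l) ((hy.2.trans (h1 y)).trans_lt hlt)
  simp only [halfLevels, Set.mem_ofPred_eq, this, measure_empty, mul_zero] at hl
  exact (h.ball_pos z r hr).ne' (le_antisymm hl zero_le)

theorem bddAbove_halfLevels (h : IsDoubling μ cd) (hr : 0 < r) (h1 : ∀ x, f x ≤ 1) (z : X) :
    BddAbove (halfLevels μ f r z) :=
  ⟨1, fun _ => le_one_of_mem_halfLevels h hr h1⟩

theorem median_le_one (h : IsDoubling μ cd) (hr : 0 < r) (h1 : ∀ x, f x ≤ 1) (z : X) :
    median μ f r z ≤ 1 :=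
  Real.sSup_le (fun _ => le_one_of_mem_halfLevels h hr h1) zero_le_one

theorem le_median (h : IsDoubling μ cd) (hr : 0 < r) (h1 : ∀ x, f x ≤ 1) {l : ℝ} {z : X}
    (hl : ∀ y ∈ Metric.ball z r, l ≤ f y) : l ≤ median μ f r z :=
  le_csSup (bddAbove_halfLevels h hr h1 z) (mem_halfLevels_of_forall_le hl)

/-- A level above the supremum is reached on less than half of the ball, so the rest has at least
half. Only subadditivity is used, so `f` need not be measurable. -/
theorem le_two_mul_of_median_lt (h : IsDoubling μ cd) (hr : 0 < r) (h1 : ∀ x, f x ≤ 1)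
    {l : ℝ} {z : X} (hl : median μ f r z < l) :
    μ (Metric.ball z r) ≤ 2 * μ (Metric.ball z r ∩ {y | f y < l}) := by
  have h2 : l ∉ halfLevels μ f r z := notMem_of_csSup_lt hl (bddAbove_halfLevels h hr h1 z)
  simp only [halfLevels, Set.mem_ofPred_eq, not_le] at h2
  by_contra! h3
  have h4 : μ (Metric.ball z r) ≤ μ (Metric.ball z r ∩ {y | l ≤ f y})
      + μ (Metric.ball z r ∩ {y | f y < l}) := by
    refine (measure_mono fun y hy => ?_).trans (measure_union_le _ _)
    rcases le_or_gt l (f y) with h | h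
    · exact Or.inl ⟨hy, h⟩
    · exact Or.inr ⟨hy, h⟩
  have h5 := ENNReal.add_lt_add h2 h3
  rw [← mul_add, ← two_mul] at h5
  exact absurd (h5.trans_le (mul_le_mul_right h4 2)) (lt_irrefl _)

variable {p : ℝ} {φ : X → ℝ≥0∞} {E : Set X}

/-- Both `{f ≥ l}` near `z` and `{f < median + ε}` near `w` carry half of their balls, so each
contains a point off `E` where `φ` is below its local mean. Comparing `f` at these two points is
enough. -/
theorem ofReal_median_sub_le (h : IsDoubling μ cd) (hp : 0 < p) (hr : 0 < r)
    (h0 : ∀ x, 0 ≤ f x) (h1 : ∀ x, f x ≤ 1) (hφ : Measurable φ) (hE : μ E = 0)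
    {x y z w : X} (hz : dist z x < 3 * r) (hw : dist w y < 3 * r) {D : ℝ≥0∞}
    (H : ∀ z' ∈ Metric.ball z r, z' ∉ E → ∀ w' ∈ Metric.ball w r, w' ∉ E →
      φ z' ≤ averageOp μ cd p r φ x → φ w' ≤ averageOp μ cd p r φ y →
        ENNReal.ofReal (f z' - f w') ≤ D) :
    ENNReal.ofReal (median μ f r z - median μ f r w) ≤ D := by
  rcases eq_or_ne D ∞ with rfl | hD
  · exact le_top
  refine ENNReal.ofReal_le_of_le_toReal (sub_le_iff_le_add.2 ?_)
  refine csSup_le ⟨0, mem_halfLevels_of_forall_le fun y _ => h0 y⟩ fun l hl => ?_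
  refine le_of_forall_pos_le_add fun ε hε => ?_
  obtain ⟨z', ⟨hz1, hz2⟩, hzE, hz3⟩ := exists_le_averageOp h hp hr hφ hz
    Set.inter_subset_left hl hE
  obtain ⟨w', ⟨hw1, hw2⟩, hwE, hw3⟩ := exists_le_averageOp h hp hr hφ hw
    Set.inter_subset_left
    (le_two_mul_of_median_lt h hr h1 (lt_add_of_pos_right (median μ f r w) hε)) hE
  have := (ENNReal.ofReal_le_iff_le_toReal hD).1 (H z' hz1 hzE w' hw1 hwE hz3 hw3)
  simp only [Set.mem_ofPred_eq] at hz2 hw2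
  linarith

theorem ofReal_median_le (h : IsDoubling μ cd) (hp : 0 < p) (hr : 0 < r)
    (h0 : ∀ x, 0 ≤ f x) (hφ : Measurable φ) (hE : μ E = 0)
    (hfφ : ∀ x ∉ E, ENNReal.ofReal (f x) ≤ φ x) {x z : X} (hz : dist z x < 3 * r) :
    ENNReal.ofReal (median μ f r z) ≤ averageOp μ cd p r φ x := by
  rcases eq_or_ne (averageOp μ cd p r φ x) ∞ with hD | hD
  · rw [hD]; exact le_top
  refine ENNReal.ofReal_le_of_le_toReal ?_
  refine csSup_le ⟨0, mem_halfLevels_of_forall_le fun y _ => h0 y⟩ fun l hl => ?_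
  obtain ⟨z', ⟨-, hz2⟩, hzE, hz3⟩ := exists_le_averageOp h hp hr hφ hz
    Set.inter_subset_left hl hE
  exact le_trans hz2 ((ENNReal.ofReal_le_iff_le_toReal hD).1 ((hfφ z' hzE).trans hz3))

end Median

/-! ### Lipschitz smoothing by averaged suprema. -/

section Smoothing

/-- The two integrals differ only on end intervals of length `ε`, where monotonicity bounds `S` by
`S 3` above and by `S 1` below. -/
theorem integral_shift_sub_le {S : ℝ → ℝ} (hS : Monotone S) {ε : ℝ} (h0 : 0 ≤ ε)
    (h1 : ε ≤ 1) :
    (∫ t in (1 : ℝ)..2, S (t + ε)) - ∫ t in (1 : ℝ)..2, S t ≤ ε * (S 3 - S 1) := by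
  have hi : ∀ a b, IntervalIntegrable S volume a b := fun a b => hS.intervalIntegrable
  rw [intervalIntegral.integral_comp_add_right (fun t => S t)]
  have e1 := intervalIntegral.integral_add_adjacent_intervals (hi (1 + ε) 2) (hi 2 (2 + ε))
  have e2 := intervalIntegral.integral_add_adjacent_intervals (hi 1 (1 + ε)) (hi (1 + ε) 2)
  have b1 : ∫ t in (2 : ℝ)..(2 + ε), S t ≤ ∫ _ in (2 : ℝ)..(2 + ε), S 3 :=
    intervalIntegral.integral_mono_on (by linarith) (hi _ _) intervalIntegrable_const
      fun t ht => hS (by linarith [ht.2])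
  have b2 : ∫ _ in (1 : ℝ)..(1 + ε), S 1 ≤ ∫ t in (1 : ℝ)..(1 + ε), S t :=
    intervalIntegral.integral_mono_on (by linarith) intervalIntegrable_const (hi _ _)
      fun t ht => hS ht.1
  simp only [intervalIntegral.integral_const, smul_eq_mul, add_sub_cancel_left] at b1 b2
  rw [mul_sub]
  linarith

variable {X : Type*} [MetricSpace X]

/-- The supremum of `a` over the ball `B(x, t)`. -/
noncomputable def ballSup (a : X → ℝ) (x : X) (t : ℝ) : ℝ := sSup (a '' Metric.ball x t)

/-- The average of the suprema of `a` over the balls `B(x, r t)`, `1 ≤ t ≤ 2`. -/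
noncomputable def smoothing (a : X → ℝ) (r : ℝ) (x : X) : ℝ :=
  ∫ t in (1 : ℝ)..2, ballSup a x (r * t)

variable {a : X → ℝ} {r : ℝ}

theorem bddAbove_image_of_le_one {Y : Type*} {a : Y → ℝ} (h1 : ∀ x, a x ≤ 1) (s : Set Y) : BddAbove (a '' s) :=
  ⟨1, by rintro _ ⟨y, -, rfl⟩; exact h1 y⟩

theorem le_ballSup (h1 : ∀ x, a x ≤ 1) {x y : X} {t : ℝ} (hy : dist y x < t) :
    a y ≤ ballSup a x t :=
  le_csSup (bddAbove_image_of_le_one h1 _) ⟨y, hy, rfl⟩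

theorem ballSup_le {x : X} {t c : ℝ} (hc : 0 ≤ c) (h : ∀ y, dist y x < t → a y ≤ c) :
    ballSup a x t ≤ c :=
  Real.sSup_le (by rintro _ ⟨y, hy, rfl⟩; exact h y hy) hc

theorem ballSup_nonneg (h0 : ∀ x, 0 ≤ a x) (x : X) (t : ℝ) : 0 ≤ ballSup a x t :=
  Real.sSup_nonneg (by rintro _ ⟨y, -, rfl⟩; exact h0 y)

theorem ballSup_le_ballSup (h0 : ∀ x, 0 ≤ a x) (h1 : ∀ x, a x ≤ 1) {x y : X} {t t' : ℝ}
    (h : t + dist x y ≤ t') : ballSup a x t ≤ ballSup a y t' :=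
  ballSup_le (ballSup_nonneg h0 y t') fun z hz => le_ballSup h1 (by
    linarith [dist_triangle z x y])

/-- This includes `t ≤ 0`: the ball is then empty and its supremum is the default value `0`, which
is below all others because `a ≥ 0`. -/
theorem monotone_ballSup (h0 : ∀ x, 0 ≤ a x) (h1 : ∀ x, a x ≤ 1) (hr : 0 < r) (x : X) :
    Monotone fun t => ballSup a x (r * t) := fun _ _ h =>
  ballSup_le_ballSup h0 h1 (by rw [dist_self, add_zero]; gcongr)

theorem intervalIntegrable_ballSup (h0 : ∀ x, 0 ≤ a x) (h1 : ∀ x, a x ≤ 1) (hr : 0 < r)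
    (x : X) (b c : ℝ) : IntervalIntegrable (fun t => ballSup a x (r * t)) volume b c :=
  (monotone_ballSup h0 h1 hr x).intervalIntegrable

theorem smoothing_le (h0 : ∀ x, 0 ≤ a x) (h1 : ∀ x, a x ≤ 1) (hr : 0 < r) (x : X) {c : ℝ}
    (hc : 0 ≤ c) (h : ∀ y, dist y x < 3 * r → a y ≤ c) : smoothing a r x ≤ c := by
  have : smoothing a r x ≤ ∫ _ in (1 : ℝ)..2, c :=
    intervalIntegral.integral_mono_on (by norm_num) (intervalIntegrable_ballSup h0 h1 hr x _ _)
      intervalIntegrable_const fun t ht => ballSup_le hc fun y hy => h y (by nlinarith [ht.2])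
  refine this.trans_eq ?_
  rw [intervalIntegral.integral_const, smul_eq_mul]; ring

theorem le_smoothing (h0 : ∀ x, 0 ≤ a x) (h1 : ∀ x, a x ≤ 1) (hr : 0 < r) (x : X) :
    a x ≤ smoothing a r x := by
  have : ∫ _ in (1 : ℝ)..2, a x ≤ smoothing a r x :=
    intervalIntegral.integral_mono_on (by norm_num) intervalIntegrable_const
      (intervalIntegrable_ballSup h0 h1 hr x _ _) fun t ht => le_ballSup h1 (by
        rw [dist_self]; nlinarith [ht.1])
  refine le_trans (le_of_eq ?_) this
  rw [intervalIntegral.integral_const, smul_eq_mul]; ring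

theorem smoothing_sub_le (h0 : ∀ x, 0 ≤ a x) (h1 : ∀ x, a x ≤ 1) (hr : 0 < r) {x y : X}
    {D : ℝ} (hD : 0 ≤ D) (h : ∀ z, dist z x < 3 * r → a z - a y ≤ D) :
    smoothing a r x - smoothing a r y ≤ D := by
  have := smoothing_le h0 h1 hr x (add_nonneg hD (h0 y)) fun z hz => by linarith [h z hz]
  linarith [le_smoothing h0 h1 hr y]

/-- Moving the centre by `dist x y` is absorbed by enlarging the radius, i.e. by shifting `t` by
`dist x y / r`. The oscillation `S 3 - S 1` about `y` is at most `D`, as `a y ≤ S 1`. -/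
theorem smoothing_sub_le_of_dist_le (h0 : ∀ x, 0 ≤ a x) (h1 : ∀ x, a x ≤ 1) (hr : 0 < r)
    {x y : X} (hxy : dist x y ≤ r) {D : ℝ} (hD : 0 ≤ D)
    (h : ∀ z, dist z y < 3 * r → a z - a y ≤ D) :
    smoothing a r x - smoothing a r y ≤ dist x y / r * D := by
  have hm := monotone_ballSup h0 h1 hr y
  have e1 : smoothing a r x ≤ ∫ t in (1 : ℝ)..2, ballSup a y (r * (t + dist x y / r)) := by
    refine intervalIntegral.integral_mono_on (by norm_num)
      (intervalIntegrable_ballSup h0 h1 hr x _ _)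
      (Monotone.intervalIntegrable fun s t hst => hm (by gcongr)) fun t _ => ?_
    refine ballSup_le_ballSup h0 h1 (le_of_eq ?_)
    field_simp
  have e2 := integral_shift_sub_le hm (ε := dist x y / r) (by positivity)
    ((div_le_one hr).2 hxy)
  have e3 : ballSup a y (r * 3) ≤ D + a y :=
    ballSup_le (add_nonneg hD (h0 y)) fun z hz => by linarith [h z (by linarith)]
  have e4 : a y ≤ ballSup a y (r * 1) := le_ballSup h1 (by simpa using hr)
  calc smoothing a r x - smoothing a r y
      ≤ dist x y / r * (ballSup a y (r * 3) - ballSup a y (r * 1)) := by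
        refine le_trans ?_ e2
        exact sub_le_sub_right e1 _
    _ ≤ dist x y / r * D := by gcongr; linarith

theorem smoothing_nonneg (h0 : ∀ x, 0 ≤ a x) (h1 : ∀ x, a x ≤ 1) (hr : 0 < r) (x : X) :
    0 ≤ smoothing a r x := (h0 x).trans (le_smoothing h0 h1 hr x)

theorem lipschitzWith_smoothing (h0 : ∀ x, 0 ≤ a x) (h1 : ∀ x, a x ≤ 1) (hr : 0 < r) :
    LipschitzWith (Real.toNNReal (1 / r)) (smoothing a r) := by
  refine LipschitzWith.of_le_add_mul _ fun x y => ?_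
  rw [Real.coe_toNNReal _ (by positivity), ← sub_le_iff_le_add']
  rcases le_total (dist x y) r with hxy | hxy
  · refine (smoothing_sub_le_of_dist_le h0 h1 hr hxy zero_le_one
      fun z _ => by linarith [h1 z, h0 y]).trans (le_of_eq ?_)
    ring
  · refine (smoothing_sub_le h0 h1 hr zero_le_one
      fun z _ => by linarith [h1 z, h0 y]).trans ?_
    rw [one_div_mul_eq_div]
    exact (one_le_div hr).2 hxy

end Smoothing

section SmoothingENNReal

variable {X : Type*} [MetricSpace X] {a : X → ℝ} {r : ℝ}

theorem ofReal_smoothing_sub_le (h0 : ∀ x, 0 ≤ a x) (h1 : ∀ x, a x ≤ 1) (hr : 0 < r) {x y : X}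
    {D : ℝ≥0∞} (h : ∀ z, dist z x < 3 * r → ENNReal.ofReal (a z - a y) ≤ D) :
    ENNReal.ofReal (smoothing a r x - smoothing a r y) ≤ D := by
  rcases eq_or_ne D ∞ with rfl | hD
  · exact le_top
  exact ENNReal.ofReal_le_of_le_toReal (smoothing_sub_le h0 h1 hr ENNReal.toReal_nonneg
    fun z hz => (ENNReal.ofReal_le_iff_le_toReal hD).1 (h z hz))

theorem ofReal_smoothing_sub_le_of_dist_le (h0 : ∀ x, 0 ≤ a x) (h1 : ∀ x, a x ≤ 1)
    (hr : 0 < r) {x y : X} (hxy : dist x y ≤ r) {D : ℝ≥0∞}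
    (h : ∀ z, dist z y < 3 * r → ENNReal.ofReal (a z - a y) ≤ D) :
    ENNReal.ofReal (smoothing a r x - smoothing a r y) ≤ ENNReal.ofReal (dist x y / r) * D := by
  rcases eq_or_ne x y with rfl | hne
  · simp
  have hd : 0 < dist x y / r := div_pos (dist_pos.2 hne) hr
  rcases eq_or_ne D ∞ with rfl | hD
  · rw [ENNReal.mul_top (by simpa using hd)]; exact le_top
  refine (ENNReal.ofReal_le_ofReal (smoothing_sub_le_of_dist_le h0 h1 hr hxy
    ENNReal.toReal_nonneg
    fun z hz => (ENNReal.ofReal_le_iff_le_toReal hD).1 (h z hz))).trans ?_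
  rw [ENNReal.ofReal_mul hd.le, ENNReal.ofReal_toReal hD]

end SmoothingENNReal

/-! ### Pointwise gradient estimates for the smoothing. -/

/-- The pointwise inequality defining fractional `s`-gradients, for a real-valued function and
off a given exceptional set. -/
def IsGradientOff {X : Type*} [MetricSpace X] (E : Set X) (s : ℝ) (f : X → ℝ)
    (g : ℤ → X → ℝ≥0∞) : Prop :=
  ∀ k : ℤ, ∀ x ∉ E, ∀ y ∉ E, (2 : ℝ) ^ (-k - 1) ≤ dist x y → dist x y < (2 : ℝ) ^ (-k) →
    ENNReal.ofReal |f x - f y| ≤ ENNReal.ofReal (dist x y ^ s) * (g k x + g k y)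

/-- The sum of three consecutive terms of a sequence of functions. -/
def adjacentSum {X : Type*} (g : ℤ → X → ℝ≥0∞) (k : ℤ) (x : X) : ℝ≥0∞ :=
  g (k + -1) x + (g k x + g (k + 1) x)

/-- The weighted supremum of the terms of a gradient that belong to scales below `2 ^ (5 - m)`. -/
noncomputable def localSup {X : Type*} (s : ℝ) (m : ℤ) (g : ℤ → X → ℝ≥0∞) (x : X) : ℝ≥0∞ :=
  ⨆ n : ℕ, ENNReal.ofReal (((2 : ℝ) ^ (5 - m - n : ℤ)) ^ s) * g (m - 5 + n) x

/-- The weight of scale `2 ^ (-k)` in the gradient of a smoothing at scale `2 ^ (-m)`. -/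
noncomputable def scaleWeight (s : ℝ) (m k : ℤ) : ℝ≥0∞ :=
  if m - 4 ≤ k then ENNReal.ofReal (2 * (((2 : ℝ) ^ (-k)) ^ (1 - s) * 2 ^ m)) else 0

/-- A fractional gradient for the smoothing at scale `2 ^ (-m)` of a function with
gradient `g`. -/
noncomputable def smoothingGradient {X : Type*} [MetricSpace X] [MeasurableSpace X]
    (μ : Measure X) (cd : ℝ≥0) (s p : ℝ) (m : ℤ) (g : ℤ → X → ℝ≥0∞) (k : ℤ) (x : X) : ℝ≥0∞ :=
  2 * averageOp μ cd p (2 ^ (-m)) (adjacentSum g k) x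
    + scaleWeight s m k * averageOp μ cd p (2 ^ (-m)) (localSup s m g) x

section Sequence

variable {X : Type*} {s : ℝ} {g : ℤ → X → ℝ≥0∞}

theorem le_adjacentSum (g : ℤ → X → ℝ≥0∞) {j k : ℤ} (h1 : k - 1 ≤ j) (h2 : j ≤ k + 1) (x : X) :
    g j x ≤ adjacentSum g k x := by
  unfold adjacentSum
  obtain rfl | rfl | rfl : j = k + -1 ∨ j = k ∨ j = k + 1 := by lia
  · exact le_self_add
  · exact le_add_left le_self_add
  · exact le_add_left le_add_self

variable [MeasurableSpace X]

theorem measurable_adjacentSum (hg : ∀ k, Measurable (g k)) (k : ℤ) :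
    Measurable (adjacentSum g k) :=
  (hg _).add ((hg _).add (hg _))

theorem measurable_localSup (hg : ∀ k, Measurable (g k)) (m : ℤ) :
    Measurable (localSup s m g) :=
  Measurable.iSup fun _ => (hg _).const_mul _

end Sequence

section Gradient

variable {X : Type*} [MetricSpace X] {E : Set X} {s : ℝ} {f : X → ℝ} {g : ℤ → X → ℝ≥0∞}

theorem IsGradientOff.exists_scale (hg : IsGradientOff E s f g) {x y : X} (hx : x ∉ E)
    (hy : y ∉ E) (hxy : x ≠ y) :
    ∃ j : ℤ, (2 : ℝ) ^ (-j - 1) ≤ dist x y ∧ dist x y < (2 : ℝ) ^ (-j) ∧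
      ENNReal.ofReal (f x - f y) ≤ ENNReal.ofReal (dist x y ^ s) * (g j x + g j y) := by
  obtain ⟨n, hn1, hn2⟩ := exists_mem_Ico_zpow (dist_pos.2 hxy) one_lt_two
  have e1 : -(-(n + 1)) - 1 = n := by ring
  have e2 : -(-(n + 1)) = n + 1 := by ring
  have h1 : (2 : ℝ) ^ (-(-(n + 1)) - 1) ≤ dist x y := by rwa [e1]
  have h2 : dist x y < (2 : ℝ) ^ (-(-(n + 1))) := by rwa [e2]
  exact ⟨-(n + 1), h1, h2, (ENNReal.ofReal_le_ofReal (le_abs_self _)).trans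
    (hg _ x hx y hy h1 h2)⟩

/-- Displacements below `4 r ≤ dist x y / 4` keep `dist z w` between half and twice `dist x y`, so
its dyadic scale differs from `k` by at most one. -/
theorem IsGradientOff.le_of_far (hg : IsGradientOff E s f g) (hs0 : 0 < s) (hs1 : s < 1)
    {x y z w : X} (hz : z ∉ E) (hw : w ∉ E) {k : ℤ} {r : ℝ} (hzx : dist z x < 4 * r)
    (hwy : dist w y < 4 * r) (hr : 16 * r ≤ dist x y)
    (hk1 : (2 : ℝ) ^ (-k - 1) ≤ dist x y) (hk2 : dist x y < (2 : ℝ) ^ (-k)) :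
    ENNReal.ofReal (f z - f w)
      ≤ ENNReal.ofReal (dist x y ^ s) * (2 * (adjacentSum g k z + adjacentSum g k w)) := by
  rcases eq_or_ne z w with rfl | hne
  · simp
  obtain ⟨j, hj1, hj2, hj⟩ := hg.exists_scale hz hw hne
  have hlow : dist x y / 2 < dist z w := by
    linarith [dist_triangle4 x z w y, dist_comm x z]
  have hup : dist z w < 2 * dist x y := by
    have : 0 ≤ dist x y := dist_nonneg
    linarith [dist_triangle4 z x y w, dist_comm y w]
  have hj3 : j ≤ k + 1 := by
    have : (2 : ℝ) ^ (-k - 1 - 1) < (2 : ℝ) ^ (-j) := by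
      rw [zpow_sub_one₀ two_ne_zero]
      linarith
    have := (zpow_lt_zpow_iff_right₀ one_lt_two).1 this
    lia
  have hj4 : k - 1 ≤ j := by
    have : (2 : ℝ) ^ (-j - 1) < (2 : ℝ) ^ (-k + 1) := by
      rw [zpow_add_one₀ two_ne_zero]
      linarith
    have := (zpow_lt_zpow_iff_right₀ one_lt_two).1 this
    lia
  have hpow : dist z w ^ s ≤ dist x y ^ s * 2 := by
    calc dist z w ^ s ≤ (2 * dist x y) ^ s :=
          Real.rpow_le_rpow dist_nonneg hup.le hs0.le
      _ = 2 ^ s * dist x y ^ s := Real.mul_rpow zero_le_two dist_nonneg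
      _ ≤ 2 ^ (1 : ℝ) * dist x y ^ s := by
          gcongr
          exact one_le_two
      _ = _ := by rw [Real.rpow_one, mul_comm]
  calc ENNReal.ofReal (f z - f w) ≤ _ := hj
    _ ≤ ENNReal.ofReal (dist x y ^ s * 2) * (adjacentSum g k z + adjacentSum g k w) := by
        gcongr
        · exact le_adjacentSum g hj4 hj3 z
        · exact le_adjacentSum g hj4 hj3 w
    _ = _ := by
        rw [ENNReal.ofReal_mul (by positivity), ENNReal.ofReal_ofNat, mul_assoc]

theorem IsGradientOff.le_of_near (hg : IsGradientOff E s f g) (hs0 : 0 < s) {z w : X}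
    (hz : z ∉ E) (hw : w ∉ E) {m : ℤ} (hd : dist z w < 32 * 2 ^ (-m)) :
    ENNReal.ofReal (f z - f w) ≤ localSup s m g z + localSup s m g w := by
  rcases eq_or_ne z w with rfl | hne
  · simp
  obtain ⟨j, hj1, hj2, hj⟩ := hg.exists_scale hz hw hne
  have hjm : m - 5 ≤ j := by
    have : (2 : ℝ) ^ (-j - 1) < (2 : ℝ) ^ (5 + -m) := by
      rw [zpow_add₀ two_ne_zero]
      norm_num at hd ⊢
      linarith
    have := (zpow_lt_zpow_iff_right₀ one_lt_two).1 this
    lia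
  obtain ⟨n, hn⟩ := Int.eq_ofNat_of_zero_le (sub_nonneg.2 hjm)
  obtain rfl : j = m - 5 + n := by lia
  have hle : ∀ y, ENNReal.ofReal (dist z w ^ s) * g (m - 5 + n) y ≤ localSup s m g y := by
    intro y
    refine le_trans ?_ (le_iSup (fun n : ℕ =>
      ENNReal.ofReal (((2 : ℝ) ^ (5 - m - n : ℤ)) ^ s) * g (m - 5 + n) y) n)
    gcongr
    rw [show 5 - m - (n : ℤ) = -(m - 5 + n) by ring]
    exact hj2.le
  refine hj.trans ?_
  rw [mul_add]
  exact add_le_add (hle z) (hle w)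

variable [MeasurableSpace X] {μ : Measure X} {cd : ℝ≥0} {p : ℝ}

theorem ofReal_smoothing_sub_le_of_far (h : IsDoubling μ cd) (hs0 : 0 < s) (hs1 : s < 1)
    (hp : 0 < p) (h0 : ∀ x, 0 ≤ f x) (h1 : ∀ x, f x ≤ 1) (hg : IsGradientOff E s f g)
    (hgm : ∀ k, Measurable (g k)) (hE : μ E = 0) {k : ℤ} {r : ℝ} (hr : 0 < r) {x y : X}
    (hd : 16 * r ≤ dist x y)
    (hk1 : (2 : ℝ) ^ (-k - 1) ≤ dist x y) (hk2 : dist x y < (2 : ℝ) ^ (-k)) :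
    ENNReal.ofReal (smoothing (median μ f r) r x - smoothing (median μ f r) r y)
      ≤ ENNReal.ofReal (dist x y ^ s) * (2 * (averageOp μ cd p r (adjacentSum g k) x
        + averageOp μ cd p r (adjacentSum g k) y)) := by
  refine ofReal_smoothing_sub_le (fun z => le_median h hr h1 fun y _ => h0 y)
    (median_le_one h hr h1) hr fun z hz => ?_
  refine ofReal_median_sub_le h hp hr h0 h1 (measurable_adjacentSum hgm k) hE hz
    (by rw [dist_self]; linarith : dist y y < 3 * r) fun z' hz' hzE w' hw' hwE hz3 hw3 => ?_
  rw [Metric.mem_ball] at hz' hw'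
  refine (hg.le_of_far hs0 hs1 hzE hwE (by linarith [dist_triangle z' z x]) (by linarith)
    hd hk1 hk2).trans ?_
  gcongr

theorem ofReal_smoothing_sub_le_of_near (h : IsDoubling μ cd) (hs0 : 0 < s)
    (hp : 0 < p) (h0 : ∀ x, 0 ≤ f x) (h1 : ∀ x, f x ≤ 1) (hg : IsGradientOff E s f g)
    (hgm : ∀ k, Measurable (g k)) (hE : μ E = 0) {m : ℤ} {r : ℝ} (hr : r = 2 ^ (-m)) {x y : X}
    (hd : dist x y < 16 * r) :
    ENNReal.ofReal (smoothing (median μ f r) r x - smoothing (median μ f r) r y)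
      ≤ ENNReal.ofReal (2 * (dist x y / r)) * (averageOp μ cd p r (localSup s m g) x
        + averageOp μ cd p r (localSup s m g) y) := by
  have hr0 : 0 < r := by rw [hr]; positivity
  have hmed0 : ∀ z, 0 ≤ median μ f r z := fun z => le_median h hr0 h1 fun y _ => h0 y
  -- The auxiliary centre `x'` is `y` when `dist x y ≤ r` and `x` otherwise. The points compared are
  -- less than `r + 3r + 16r + r = 21r` apart, within the `32r` of `le_of_near`.
  have key : ∀ x', dist x' y < 16 * r → ∀ z, dist z x' < 3 * r →
      ENNReal.ofReal (median μ f r z - median μ f r y)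
        ≤ averageOp μ cd p r (localSup s m g) x' + averageOp μ cd p r (localSup s m g) y := by
    intro x' hx' z hz
    refine ofReal_median_sub_le h hp hr0 h0 h1 (measurable_localSup (s := s) hgm m) hE hz
      (by rw [dist_self]; linarith : dist y y < 3 * r) fun z' hz' hzE w' hw' hwE hz3 hw3 => ?_
    rw [Metric.mem_ball] at hz' hw'
    refine (hg.le_of_near hs0 hzE hwE (m := m) ?_).trans (add_le_add hz3 hw3)
    rw [← hr]
    linarith [dist_triangle4 z' z x' y, dist_triangle z' y w', dist_comm y w']
  rw [ENNReal.ofReal_mul zero_le_two, ENNReal.ofReal_ofNat]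
  rcases le_total (dist x y) r with hxy | hxy
  · refine (ofReal_smoothing_sub_le_of_dist_le hmed0 (median_le_one h hr0 h1) hr0 hxy
      (key y (by rw [dist_self]; linarith))).trans ?_
    rw [← two_mul, mul_comm 2 (ENNReal.ofReal _), mul_assoc]
    gcongr
    exact le_add_self
  · refine (ofReal_smoothing_sub_le hmed0 (median_le_one h hr0 h1) hr0 (key x hd)).trans ?_
    have : 1 ≤ ENNReal.ofReal (dist x y / r) := by
      rw [ENNReal.one_le_ofReal]
      exact (one_le_div hr0).2 hxy
    exact le_mul_of_one_le_left' (one_le_two.trans (le_mul_of_one_le_right' this))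

theorem ofReal_two_mul_dist_div_le {m k : ℤ} {r d : ℝ} (hs1 : s < 1) (hr : r = 2 ^ (-m))
    (hd : d < 16 * r) (hk1 : (2 : ℝ) ^ (-k - 1) ≤ d) (hk2 : d < (2 : ℝ) ^ (-k)) :
    ENNReal.ofReal (2 * (d / r)) ≤ ENNReal.ofReal (d ^ s) * scaleWeight s m k := by
  have hd0 : 0 < d := lt_of_lt_of_le (by positivity) hk1
  have hkm : m - 4 ≤ k := by
    have : (2 : ℝ) ^ (-k - 1) < (2 : ℝ) ^ (4 + -m) := by
      rw [zpow_add₀ two_ne_zero, ← hr]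
      norm_num at hd ⊢
      linarith
    have := (zpow_lt_zpow_iff_right₀ one_lt_two).1 this
    lia
  rw [scaleWeight, if_pos hkm, ← ENNReal.ofReal_mul (by positivity)]
  apply ENNReal.ofReal_le_ofReal
  have e1 : d = d ^ s * d ^ (1 - s) := by
    rw [← Real.rpow_add hd0, add_sub_cancel, Real.rpow_one]
  have e2 : d ^ (1 - s) ≤ ((2 : ℝ) ^ (-k)) ^ (1 - s) :=
    Real.rpow_le_rpow hd0.le hk2.le (by linarith)
  calc 2 * (d / r) = 2 * d * 2 ^ m := by rw [hr, zpow_neg]; field_simp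
    _ = d ^ s * (2 * (d ^ (1 - s) * 2 ^ m)) := by nth_rewrite 1 [e1]; ring
    _ ≤ _ := by gcongr

/-- The exceptional set becomes empty: `E` is avoided when choosing the comparison points, never by
`x` and `y`. -/
theorem smoothingGradient_spec (h : IsDoubling μ cd) (hs0 : 0 < s) (hs1 : s < 1)
    (hp : 0 < p) (h0 : ∀ x, 0 ≤ f x) (h1 : ∀ x, f x ≤ 1) (hg : IsGradientOff E s f g)
    (hgm : ∀ k, Measurable (g k)) (hE : μ E = 0) (m : ℤ) :
    IsGradientOff ∅ s (smoothing (median μ f (2 ^ (-m))) (2 ^ (-m)))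
      (smoothingGradient μ cd s p m g) := by
  have key : ∀ (k : ℤ) (x y : X), (2 : ℝ) ^ (-k - 1) ≤ dist x y → dist x y < (2 : ℝ) ^ (-k) →
      ENNReal.ofReal (smoothing (median μ f (2 ^ (-m))) (2 ^ (-m)) x
          - smoothing (median μ f (2 ^ (-m))) (2 ^ (-m)) y)
        ≤ ENNReal.ofReal (dist x y ^ s)
          * (smoothingGradient μ cd s p m g k x + smoothingGradient μ cd s p m g k y) := by
    intro k x y hk1 hk2
    rcases le_or_gt (16 * 2 ^ (-m)) (dist x y) with hd | hd
    · refine (ofReal_smoothing_sub_le_of_far h hs0 hs1 hp h0 h1 hg hgm hE (by positivity)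
        hd hk1 hk2).trans ?_
      rw [mul_add]
      unfold smoothingGradient
      gcongr <;> exact le_self_add
    · refine (ofReal_smoothing_sub_le_of_near h hs0 hp h0 h1 hg hgm hE rfl hd).trans ?_
      refine (mul_le_mul_left (ofReal_two_mul_dist_div_le hs1 rfl hd hk1 hk2) _).trans ?_
      rw [mul_assoc, mul_add]
      unfold smoothingGradient
      gcongr <;> exact le_add_self
  intro k x _ y _ hk1 hk2
  rcases abs_choice (smoothing (median μ f (2 ^ (-m))) (2 ^ (-m)) x
    - smoothing (median μ f (2 ^ (-m))) (2 ^ (-m)) y) with e | e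
  · rw [e]; exact key k x y hk1 hk2
  · rw [e, neg_sub, add_comm, dist_comm]
    rw [dist_comm] at hk1 hk2
    exact key k y x hk1 hk2

end Gradient

/-! ### Norm of the new gradient. -/

section GradientNorm

theorem tsum_ofReal_geometric_ne_top {c t q : ℝ} (hc : 0 < c) (ht : 0 < t) (hq : 0 < q)
    (N : ℤ) : ∑' n : ℕ, ENNReal.ofReal (c * ((2 : ℝ) ^ (N - n : ℤ)) ^ t) ^ q ≠ ∞ := by
  have e : ∀ n : ℕ, ENNReal.ofReal (c * ((2 : ℝ) ^ (N - n : ℤ)) ^ t) ^ q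
      = ENNReal.ofReal ((c * ((2 : ℝ) ^ N) ^ t) ^ q * (((2 : ℝ)⁻¹ ^ t) ^ q) ^ n) := by
    intro n
    rw [ENNReal.ofReal_rpow_of_pos (by positivity)]
    congr 1
    rw [zpow_sub₀ two_ne_zero, zpow_natCast, div_eq_mul_inv, ← inv_pow,
      Real.mul_rpow (x := 2 ^ N) (by positivity) (by positivity), ← mul_assoc,
      Real.mul_rpow (by positivity) (by positivity)]
    congr 1
    rw [← Real.rpow_natCast, ← Real.rpow_natCast, ← Real.rpow_mul (by positivity),
      ← Real.rpow_mul (by positivity), ← Real.rpow_mul (by positivity),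
      ← Real.rpow_mul (by positivity)]
    congr 1; ring
  simp_rw [e]
  apply Summable.tsum_ofReal_ne_top
  refine (summable_geometric_of_lt_one (by positivity) ?_).mul_left _
  exact Real.rpow_lt_one (by positivity)
    (Real.rpow_lt_one (by positivity) (by norm_num) ht) hq

/-- The constant bounding `localSup` in `L^p`. -/
noncomputable def localConst (s p : ℝ) : ℝ≥0∞ :=
  (∑' n : ℕ, ENNReal.ofReal (1 * ((2 : ℝ) ^ (5 - n : ℤ)) ^ s) ^ p) ^ (1 / p)

/-- The constant bounding the `l^q` norm of `scaleWeight`. -/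
noncomputable def weightConst (s q : ℝ) : ℝ≥0∞ :=
  (∑' n : ℕ, ENNReal.ofReal (2 * ((2 : ℝ) ^ (4 - n : ℤ)) ^ (1 - s)) ^ q) ^ (1 / q)

variable {s p q : ℝ}

theorem localConst_ne_top (hs0 : 0 < s) (hp : 0 < p) : localConst s p ≠ ∞ :=
  ENNReal.rpow_ne_top_of_nonneg (by positivity) (tsum_ofReal_geometric_ne_top one_pos hs0 hp 5)

theorem weightConst_ne_top (hs1 : s < 1) (hq : 0 < q) : weightConst s q ≠ ∞ :=
  ENNReal.rpow_ne_top_of_nonneg (by positivity)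
    (tsum_ofReal_geometric_ne_top two_pos (sub_pos.2 hs1) hq 4)

theorem scaleWeight_ne_top (s : ℝ) (m k : ℤ) : scaleWeight s m k ≠ ∞ := by
  unfold scaleWeight
  split_ifs
  · exact ENNReal.ofReal_ne_top
  · exact ENNReal.zero_ne_top

/-- With `k = n + (m - 4)`, the factors of `2 ^ m` combine and leave `2 ^ ((4 - n) (1 - s))`, so the
bound does not depend on `m`. -/
theorem scalarNorm_scaleWeight_mul (hq : 0 < q) (m : ℤ) :
    scalarNorm Measure.count q
      (fun k : ℤ => scaleWeight s m k * ENNReal.ofReal (((2 : ℝ) ^ (-m)) ^ s))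
      = weightConst s q := by
  rw [scalarNorm, weightConst, lintegral_count]
  congr 1
  have hinj : Function.Injective fun n : ℕ => (n : ℤ) + (m - 4) := fun a b hab => by
    simpa using hab
  rw [← hinj.tsum_eq]
  · refine tsum_congr fun n => ?_
    rw [scaleWeight, if_pos (by lia), ← ENNReal.ofReal_mul (by positivity)]
    congr 2
    rw [mul_assoc, mul_assoc]
    congr 1
    have e1 : (2 : ℝ) ^ (4 - n : ℤ) = 2 ^ (-(n + (m - 4)) : ℤ) * 2 ^ m := by
      rw [← zpow_add₀ two_ne_zero]; congr 1; ring
    have e2 : (2 : ℝ) ^ m * ((2 : ℝ) ^ (-m)) ^ s = ((2 : ℝ) ^ m) ^ (1 - s) := by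
      rw [zpow_neg, Real.inv_rpow (by positivity), Real.rpow_sub (by positivity),
        Real.rpow_one, div_eq_mul_inv]
    rw [e1, e2, Real.mul_rpow (by positivity) (by positivity)]
  · intro k hk
    by_contra hk'
    apply hk
    have : ¬ m - 4 ≤ k := fun hle => hk' ⟨(k - (m - 4)).toNat, by
      simp only [Int.toNat_of_nonneg (sub_nonneg.2 hle)]; ring⟩
    simp [scaleWeight, this, hq]

variable {X : Type*} [MeasurableSpace X] {μ : Measure X} {cd : ℝ≥0} {g : ℤ → X → ℝ≥0∞}

/-- The supremum is dominated by an `l^p` sum, each `g j` has norm at most the mixed norm, and the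
remaining weights are geometric since `s > 0`. This needs no relation between `p` and `q`. -/
theorem scalarNorm_localSup_le (hp : 0 < p) (hq : 0 < q) (hgm : ∀ k, Measurable (g k)) (m : ℤ) :
    scalarNorm μ p (localSup s m g)
      ≤ ENNReal.ofReal (((2 : ℝ) ^ (-m)) ^ s) * localConst s p * mixedNorm μ p q g := by
  rw [scalarNorm_le_iff hp]
  have h1 : ∀ x, localSup s m g x ^ p ≤ ∑' n : ℕ,
      (ENNReal.ofReal (((2 : ℝ) ^ (5 - m - n : ℤ)) ^ s) * g (m - 5 + n) x) ^ p := by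
    intro x
    rw [← ENNReal.le_rpow_inv_iff hp]
    refine iSup_le fun n => ?_
    rw [ENNReal.le_rpow_inv_iff hp]
    exact ENNReal.le_tsum n
  have h2 : ∀ n : ℕ, ENNReal.ofReal (((2 : ℝ) ^ (5 - m - n : ℤ)) ^ s)
      = ENNReal.ofReal (((2 : ℝ) ^ (-m)) ^ s)
        * ENNReal.ofReal (1 * ((2 : ℝ) ^ (5 - n : ℤ)) ^ s) := by
    intro n
    rw [← ENNReal.ofReal_mul (by positivity), one_mul, ← Real.mul_rpow (by positivity)
      (by positivity), ← zpow_add₀ two_ne_zero]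
    congr 4; ring
  calc ∫⁻ x, localSup s m g x ^ p ∂μ ≤ ∫⁻ x, ∑' n : ℕ,
      (ENNReal.ofReal (((2 : ℝ) ^ (5 - m - n : ℤ)) ^ s) * g (m - 5 + n) x) ^ p ∂μ :=
        lintegral_mono h1
    _ = ∑' n : ℕ, scalarNorm μ p (fun x =>
          ENNReal.ofReal (((2 : ℝ) ^ (5 - m - n : ℤ)) ^ s) * g (m - 5 + n) x) ^ p := by
        rw [lintegral_tsum fun n => (((hgm _).const_mul _).pow_const _).aemeasurable]
        simp_rw [scalarNorm_rpow hp]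
    _ ≤ ∑' n : ℕ, (ENNReal.ofReal (((2 : ℝ) ^ (-m)) ^ s)
        * ENNReal.ofReal (1 * ((2 : ℝ) ^ (5 - n : ℤ)) ^ s) * mixedNorm μ p q g) ^ p := by
        gcongr with n
        rw [scalarNorm_const_mul hp ENNReal.ofReal_ne_top, h2]
        gcongr
        exact scalarNorm_le_mixedNorm hq g _
    _ = _ := by
        simp_rw [ENNReal.mul_rpow_of_nonneg _ _ hp.le]
        rw [ENNReal.tsum_mul_right, ENNReal.tsum_mul_left, localConst, one_div,
          ENNReal.rpow_inv_rpow hp.ne']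

theorem mixedNorm_adjacentSum_le (hp : 0 < p) (hq : 0 < q) (hgm : ∀ k, Measurable (g k)) :
    mixedNorm μ p q (adjacentSum g)
      ≤ quasiConst p * quasiConst q * (1 + quasiConst p * quasiConst q * 2)
        * mixedNorm μ p q g := by
  calc mixedNorm μ p q (adjacentSum g)
      ≤ quasiConst p * quasiConst q * (mixedNorm μ p q (fun k => g (k + -1))
        + mixedNorm μ p q (fun k x => g k x + g (k + 1) x)) :=
        mixedNorm_add_le hp hq (f := fun k => g (k + -1)) fun k => (hgm _).aemeasurable
    _ ≤ quasiConst p * quasiConst q * (mixedNorm μ p q (fun k => g (k + -1))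
        + quasiConst p * quasiConst q * (mixedNorm μ p q g
          + mixedNorm μ p q (fun k => g (k + 1)))) := by
        gcongr
        exact mixedNorm_add_le hp hq (g := fun k => g (k + 1)) fun k => (hgm _).aemeasurable
    _ = _ := by rw [mixedNorm_shift, mixedNorm_shift]; ring

/-- The constant in the estimate for the homogeneous seminorm of a smoothing. -/
noncomputable def gradientConst (s p q : ℝ) (cd : ℝ≥0) : ℝ≥0∞ :=
  quasiConst p * quasiConst q * (2 * averageBound cd p
    * (quasiConst p * quasiConst q * (1 + quasiConst p * quasiConst q * 2))
    + weightConst s q * (averageBound cd p * localConst s p))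

theorem gradientConst_ne_top (hs0 : 0 < s) (hs1 : s < 1) (hp : 0 < p) (hq : 0 < q)
    (cd : ℝ≥0) : gradientConst s p q cd ≠ ∞ := by
  have h1 := quasiConst_ne_top hp
  have h2 := quasiConst_ne_top hq
  have h3 := averageBound_ne_top cd hp
  have h4 := weightConst_ne_top hs1 hq
  have h5 := localConst_ne_top hs0 hp
  unfold gradientConst
  finiteness

variable [MetricSpace X]

theorem measurable_smoothingGradient [BorelSpace X] (h : IsDoubling μ cd)
    (hgm : ∀ k, Measurable (g k)) (m k : ℤ) :
    Measurable (smoothingGradient μ cd s p m g k) :=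
  ((measurable_averageOp h (measurable_adjacentSum hgm k)).const_mul _).add
    ((measurable_averageOp h (measurable_localSup hgm m)).const_mul _)

theorem mixedNorm_smoothingGradient_le [BorelSpace X] (h : IsDoubling μ cd) (hs0 : 0 < s)
    (hp : 0 < p) (hq : 0 < q) (hgm : ∀ k, Measurable (g k)) (hgt : mixedNorm μ p q g ≠ ∞)
    (m : ℤ) :
    mixedNorm μ p q (smoothingGradient μ cd s p m g)
      ≤ gradientConst s p q cd * mixedNorm μ p q g := by
  have hr : (0 : ℝ) < 2 ^ (-m) := by positivity
  have h1 : mixedNorm μ p q (fun k x => 2 * averageOp μ cd p (2 ^ (-m)) (adjacentSum g k) x)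
      ≤ 2 * averageBound cd p * (quasiConst p * quasiConst q
        * (1 + quasiConst p * quasiConst q * 2) * mixedNorm μ p q g) := by
    refine le_trans ?_ (mul_le_mul_right (mixedNorm_adjacentSum_le (μ := μ) hp hq hgm) _)
    rw [mixedNorm_eq, mixedNorm_eq, ← scalarNorm_const_mul hq
      (ENNReal.mul_ne_top ENNReal.ofNat_ne_top (averageBound_ne_top cd hp))]
    refine scalarNorm_mono hq fun k => ?_
    rw [scalarNorm_const_mul hp ENNReal.ofNat_ne_top, mul_assoc]
    gcongr
    exact scalarNorm_averageOp_le h hp hr (measurable_adjacentSum hgm k)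
  have h2 : mixedNorm μ p q
      (fun k x => scaleWeight s m k * averageOp μ cd p (2 ^ (-m)) (localSup s m g) x)
      ≤ weightConst s q * (averageBound cd p * localConst s p * mixedNorm μ p q g) := by
    rw [mixedNorm_eq, ← scalarNorm_scaleWeight_mul hq m, ← scalarNorm_mul_const hq
      (ENNReal.mul_ne_top (ENNReal.mul_ne_top (averageBound_ne_top cd hp)
        (localConst_ne_top hs0 hp)) hgt)]
    refine scalarNorm_mono hq fun k => ?_
    rw [scalarNorm_const_mul hp (scaleWeight_ne_top s m k), mul_assoc]
    gcongr
    refine (scalarNorm_averageOp_le h hp hr (measurable_localSup hgm m)).trans ?_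
    refine (mul_le_mul_right (scalarNorm_localSup_le hp hq hgm m) _).trans (le_of_eq ?_)
    ring
  calc mixedNorm μ p q (smoothingGradient μ cd s p m g)
      ≤ quasiConst p * quasiConst q * (_ + _) := mixedNorm_add_le hp hq fun k =>
        ((measurable_averageOp h (measurable_adjacentSum hgm k)).const_mul _).aemeasurable
    _ ≤ quasiConst p * quasiConst q * (2 * averageBound cd p * (quasiConst p * quasiConst q
        * (1 + quasiConst p * quasiConst q * 2) * mixedNorm μ p q g)
        + weightConst s q * (averageBound cd p * localConst s p * mixedNorm μ p q g)) := by
        gcongr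
    _ = _ := by rw [gradientConst]; ring

end GradientNorm

/-! ### Truncation to the unit interval. -/

section Truncation

/-- The truncation of an extended real number to the interval `[0, 1]`. -/
noncomputable def unitTruncation (t : EReal) : ℝ := (max 0 (min t 1)).toReal

theorem unitTruncation_coe (t : ℝ) : unitTruncation t = max 0 (min t 1) := by
  unfold unitTruncation
  have hm : Monotone ((↑) : ℝ → EReal) := EReal.coe_strictMono.monotone
  rw [← EReal.coe_one, ← EReal.coe_zero, ← hm.map_min, ← hm.map_max, EReal.toReal_coe]

theorem unitTruncation_bot : unitTruncation ⊥ = 0 := by simp [unitTruncation]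

theorem unitTruncation_top : unitTruncation ⊤ = 1 := by simp [unitTruncation]

theorem unitTruncation_nonneg (t : EReal) : 0 ≤ unitTruncation t := by
  induction t with
  | bot => rw [unitTruncation_bot]
  | top => rw [unitTruncation_top]; exact zero_le_one
  | coe t => rw [unitTruncation_coe]; exact le_max_left _ _

theorem unitTruncation_le_one (t : EReal) : unitTruncation t ≤ 1 := by
  induction t with
  | bot => rw [unitTruncation_bot]; exact zero_le_one
  | top => rw [unitTruncation_top]
  | coe t => rw [unitTruncation_coe]; exact max_le zero_le_one (min_le_right _ _)

theorem one_le_unitTruncation {t : EReal} (ht : 1 ≤ t) : 1 ≤ unitTruncation t := by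
  unfold unitTruncation
  rw [min_eq_right ht, max_eq_right zero_le_one, EReal.toReal_one]

theorem measurable_ereal_abs : Measurable EReal.abs :=
  EReal.measurable_of_measurable_real (continuous_abs.measurable.ennreal_ofReal)

theorem ofReal_unitTruncation_le_abs (t : EReal) :
    ENNReal.ofReal (unitTruncation t) ≤ t.abs := by
  induction t with
  | bot => simp
  | top => simp
  | coe t =>
    rw [unitTruncation_coe, EReal.abs_def]
    exact ENNReal.ofReal_le_ofReal (max_le (abs_nonneg t) ((min_le_left _ _).trans (le_abs_self t)))

theorem abs_unitTruncation_sub_le {t t' : EReal} (ht : t ≠ ⊥ ∧ t ≠ ⊤) (ht' : t' ≠ ⊥ ∧ t' ≠ ⊤) :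
    |unitTruncation t - unitTruncation t'| ≤ |t.toReal - t'.toReal| := by
  lift t to ℝ using ⟨ht.2, ht.1⟩
  lift t' to ℝ using ⟨ht'.2, ht'.1⟩
  rw [unitTruncation_coe, unitTruncation_coe, EReal.toReal_coe, EReal.toReal_coe]
  refine (abs_max_sub_max_le_max _ _ _ _).trans ?_
  rw [sub_self, abs_zero, max_eq_right (abs_nonneg _)]
  refine (abs_min_sub_min_le_max _ _ _ _).trans ?_
  rw [sub_self, abs_zero, max_eq_left (abs_nonneg _)]

end Truncation

/-! ### Admissibility and comparison of capacities. -/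

section Capacity

variable {X : Type*} [MetricSpace X] [MeasurableSpace X] {μ : Measure X} {cd : ℝ≥0}
  {s p q : ℝ} {u : X → EReal} {g : ℤ → X → ℝ≥0∞}

/-- The smoothing at scale `2 ^ (-m)` of the truncation of `u` to `[0, 1]`. -/
noncomputable def truncatedSmoothing (μ : Measure X) (m : ℤ) (u : X → EReal) : X → ℝ :=
  smoothing (median μ (fun x => unitTruncation (u x)) (2 ^ (-m))) (2 ^ (-m))

theorem median_unitTruncation_nonneg (h : IsDoubling μ cd) {r : ℝ} (hr : 0 < r) (x : X) :
    0 ≤ median μ (fun x => unitTruncation (u x)) r x :=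
  le_median h hr (fun x => unitTruncation_le_one (u x)) fun y _ => unitTruncation_nonneg (u y)

theorem median_unitTruncation_le_one (h : IsDoubling μ cd) {r : ℝ} (hr : 0 < r) (x : X) :
    median μ (fun x => unitTruncation (u x)) r x ≤ 1 :=
  median_le_one h hr (fun x => unitTruncation_le_one (u x)) x

/-- Truncation is 1-Lipschitz, so it keeps the gradient; the countably many null sets where the
measurable versions differ are added to `E`. -/
theorem IsFractionalGradient.exists_measurable (hg : IsFractionalGradient μ s u g) :
    ∃ g' : ℤ → X → ℝ≥0∞, (∀ k, Measurable (g' k)) ∧ (∀ k, g' k =ᵐ[μ] g k) ∧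
      ∃ E, μ E = 0 ∧ IsGradientOff E s (fun x => unitTruncation (u x)) g' := by
  obtain ⟨hm, E, hE, hfin, H⟩ := hg
  refine ⟨fun k => (hm k).mk _, fun k => (hm k).measurable_mk, fun k => (hm k).ae_eq_mk.symm,
    E ∪ ⋃ k, {x | g k x ≠ (hm k).mk _ x}, ?_, ?_⟩
  · exact measure_union_null hE (measure_iUnion_null fun k => (hm k).ae_eq_mk)
  · have haux : ∀ x ∉ E ∪ ⋃ k, {x | g k x ≠ (hm k).mk _ x},
        x ∉ E ∧ ∀ k, (hm k).mk _ x = g k x := by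
      intro x hx
      simp only [Set.mem_union, Set.mem_iUnion, Set.mem_ofPred_eq, not_or, not_exists,
        not_not] at hx
      exact ⟨hx.1, fun k => (hx.2 k).symm⟩
    intro k x hx y hy h1 h2
    obtain ⟨hx1, hx2⟩ := haux x hx
    obtain ⟨hy1, hy2⟩ := haux y hy
    simp only [hx2, hy2]
    exact (ENNReal.ofReal_le_ofReal (abs_unitTruncation_sub_le (hfin x hx1) (hfin y hy1))).trans
      (H k x hx1 y hy1 h1 h2)

theorem locallyLipschitz_truncatedSmoothing (h : IsDoubling μ cd) (m : ℤ) :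
    LocallyLipschitz (truncatedSmoothing μ m u) :=
  (lipschitzWith_smoothing (median_unitTruncation_nonneg h (by positivity))
    (median_unitTruncation_le_one h (by positivity)) (by positivity)).locallyLipschitz

variable [BorelSpace X]

theorem scalarNorm_truncatedSmoothing_le (h : IsDoubling μ cd) (hp : 0 < p)
    (hu : AEMeasurable u μ) (m : ℤ) :
    scalarNorm μ p (fun x => (truncatedSmoothing μ m u x : EReal).abs)
      ≤ averageBound cd p * scalarNorm μ p fun x => (u x).abs := by
  have hr : (0 : ℝ) < 2 ^ (-m) := by positivity
  have hua : AEMeasurable (fun x => (u x).abs) μ := measurable_ereal_abs.comp_aemeasurable hu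
  rw [scalarNorm_congr_ae hua.ae_eq_mk]
  refine le_trans (scalarNorm_mono hp fun x => ?_)
    (scalarNorm_averageOp_le h hp hr hua.measurable_mk)
  have h0 : ∀ x, 0 ≤ median μ (fun x => unitTruncation (u x)) (2 ^ (-m)) x :=
    median_unitTruncation_nonneg h hr
  have h1 : ∀ x, median μ (fun x => unitTruncation (u x)) (2 ^ (-m)) x ≤ 1 :=
    median_unitTruncation_le_one h hr
  rw [EReal.abs_def, truncatedSmoothing, abs_of_nonneg (smoothing_nonneg h0 h1 hr x)]
  rcases eq_or_ne (averageOp μ cd p (2 ^ (-m)) (hua.mk _) x) ∞ with hD | hD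
  · rw [hD]; exact le_top
  refine ENNReal.ofReal_le_of_le_toReal
    (smoothing_le h0 h1 hr x ENNReal.toReal_nonneg fun z hz => ?_)
  rw [← ENNReal.ofReal_le_iff_le_toReal hD]
  refine ofReal_median_le h hp hr (fun x => unitTruncation_nonneg (u x)) hua.measurable_mk
    (E := {x | (u x).abs ≠ hua.mk _ x}) hua.ae_eq_mk (fun y hy => ?_) hz
  simp only [Set.mem_ofPred_eq, not_not] at hy
  rw [← hy]
  exact ofReal_unitTruncation_le_abs (u y)

/-- The extra `+ 1` makes the constant nonzero, so that it times `∞` is `∞` and it can be moved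
inside the infimum over gradients. -/
theorem homNorm_truncatedSmoothing_le_mixedNorm (h : IsDoubling μ cd) (hs0 : 0 < s)
    (hs1 : s < 1) (hp : 0 < p) (hq : 0 < q) (hg : IsFractionalGradient μ s u g) (m : ℤ) :
    homNorm μ s p q (fun x => (truncatedSmoothing μ m u x : EReal))
      ≤ (gradientConst s p q cd + 1) * mixedNorm μ p q g := by
  obtain ⟨g', hgm, hgg, E, hE, hg'⟩ := hg.exists_measurable
  have e : mixedNorm μ p q g = mixedNorm μ p q g' := by
    unfold mixedNorm
    simp_rw [scalarNorm_congr_ae (hgg _)]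
  rw [e]
  rcases eq_or_ne (mixedNorm μ p q g') ∞ with htop | htop
  · rw [htop, ENNReal.mul_top (by simp)]; exact le_top
  have hspec := smoothingGradient_spec h hs0 hs1 hp (fun x => unitTruncation_nonneg (u x))
    (fun x => unitTruncation_le_one (u x)) hg' hgm hE m
  have hgrad : IsFractionalGradient μ s (fun x => (truncatedSmoothing μ m u x : EReal))
      (smoothingGradient μ cd s p m g') := by
    refine ⟨fun k => (measurable_smoothingGradient h hgm m k).aemeasurable, ∅, measure_empty,
      fun x _ => ⟨EReal.coe_ne_bot _, EReal.coe_ne_top _⟩, ?_⟩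
    simp only [EReal.toReal_coe]
    exact hspec
  calc homNorm μ s p q (fun x => (truncatedSmoothing μ m u x : EReal))
      ≤ mixedNorm μ p q (smoothingGradient μ cd s p m g') := iInf₂_le _ hgrad
    _ ≤ gradientConst s p q cd * mixedNorm μ p q g' :=
        mixedNorm_smoothingGradient_le h hs0 hp hq hgm htop m
    _ ≤ _ := by gcongr; exact le_self_add

theorem homNorm_truncatedSmoothing_le (h : IsDoubling μ cd) (hs0 : 0 < s)
    (hs1 : s < 1) (hp : 0 < p) (hq : 0 < q) (m : ℤ) :
    homNorm μ s p q (fun x => (truncatedSmoothing μ m u x : EReal))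
      ≤ (gradientConst s p q cd + 1) * homNorm μ s p q u := by
  have h0 : gradientConst s p q cd + 1 ≠ 0 := by simp
  have ht : gradientConst s p q cd + 1 ≠ ∞ := by
    simp [gradientConst_ne_top hs0 hs1 hp hq cd]
  conv_rhs => rw [homNorm]
  rw [ENNReal.mul_iInf_of_ne h0 ht]
  refine le_iInf fun g => ?_
  rw [ENNReal.mul_iInf_of_ne h0 ht]
  exact le_iInf fun hg => homNorm_truncatedSmoothing_le_mixedNorm h hs0 hs1 hp hq hg m

/-- The constant comparing the Besov norm of a truncated smoothing with that of the function. -/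
noncomputable def smoothingConst (s p q : ℝ) (cd : ℝ≥0) : ℝ≥0∞ :=
  averageBound cd p + (gradientConst s p q cd + 1)

theorem smoothingConst_ne_top (hs0 : 0 < s) (hs1 : s < 1) (hp : 0 < p) (hq : 0 < q)
    (cd : ℝ≥0) : smoothingConst s p q cd ≠ ∞ := by
  have h1 := averageBound_ne_top cd hp
  have h2 := gradientConst_ne_top hs0 hs1 hp hq cd
  unfold smoothingConst
  finiteness

theorem one_le_smoothingConst (s p q : ℝ) (cd : ℝ≥0) : 1 ≤ smoothingConst s p q cd :=
  le_add_left le_add_self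

theorem besovNorm_truncatedSmoothing_le (h : IsDoubling μ cd) (hs0 : 0 < s)
    (hs1 : s < 1) (hp : 0 < p) (hq : 0 < q) (hu : AEMeasurable u μ) (m : ℤ) :
    besovNorm μ s p q (fun x => (truncatedSmoothing μ m u x : EReal))
      ≤ smoothingConst s p q cd * besovNorm μ s p q u := by
  unfold besovNorm
  rw [mul_add]
  refine add_le_add ((scalarNorm_truncatedSmoothing_le h hp hu m).trans ?_)
    ((homNorm_truncatedSmoothing_le h hs0 hs1 hp hq m).trans ?_)
  · gcongr; exact le_self_add
  · gcongr; exact le_add_self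

theorem truncatedSmoothing_mem_besovSpace (h : IsDoubling μ cd) (hs0 : 0 < s)
    (hs1 : s < 1) (hp : 0 < p) (hq : 0 < q) (hu : u ∈ besovSpace μ s p q) (m : ℤ) :
    (fun x => (truncatedSmoothing μ m u x : EReal)) ∈ besovSpace μ s p q := by
  obtain ⟨⟨hu1, -⟩, hu2, hu3⟩ := hu
  refine ⟨⟨?_, .of_forall fun x => ⟨EReal.coe_ne_bot _, EReal.coe_ne_top _⟩⟩, ?_, ?_⟩
  · exact (locallyLipschitz_truncatedSmoothing h m).continuous.measurable.coe_real_ereal.aemeasurable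
  · exact (scalarNorm_truncatedSmoothing_le h hp hu1 m).trans_lt
      (ENNReal.mul_lt_top (averageBound_ne_top cd hp).lt_top hu2)
  · refine (homNorm_truncatedSmoothing_le h hs0 hs1 hp hq m).trans_lt
      (ENNReal.mul_lt_top ?_ hu3)
    exact ENNReal.add_lt_top.2 ⟨(gradientConst_ne_top hs0 hs1 hp hq cd).lt_top,
      ENNReal.one_lt_top⟩

theorem exists_truncatedSmoothing_mem_lipAdmissible (h : IsDoubling μ cd) (hs0 : 0 < s)
    (hs1 : s < 1) (hp : 0 < p) (hq : 0 < q) {K : Set X} (hK : IsCompact K)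
    (hu : u ∈ admissible μ s p q K) :
    ∃ m : ℤ, (fun x => (truncatedSmoothing μ m u x : EReal)) ∈ lipAdmissible μ s p q K := by
  obtain ⟨hu1, U, hU, hKU, hu2⟩ := hu
  obtain ⟨δ, hδ, hδU⟩ := hK.exists_thickening_subset_open hU hKU
  -- With `2 ^ (-n) < δ / 2`, balls of this radius centred in the `δ / 2`-thickening stay in the
  -- `δ`-thickening, where `u ≥ 1`.
  obtain ⟨n, hn⟩ := exists_pow_lt_of_lt_one (half_pos hδ) (one_half_lt_one (α := ℝ))
  have hr : (0 : ℝ) < 2 ^ (-(n : ℤ)) := by positivity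
  have hn' : (2 : ℝ) ^ (-(n : ℤ)) < δ / 2 := by
    rwa [zpow_neg, zpow_natCast, ← inv_pow, ← one_div]
  refine ⟨n, ⟨truncatedSmoothing_mem_besovSpace h hs0 hs1 hp hq hu1 n,
    Metric.thickening (δ / 2) K, Metric.isOpen_thickening,
    Metric.self_subset_thickening (half_pos hδ) K, fun x hx => ?_⟩,
    _, locallyLipschitz_truncatedSmoothing h n, fun _ => rfl⟩
  have hball : ∀ y ∈ Metric.ball x (2 ^ (-(n : ℤ))), 1 ≤ unitTruncation (u y) := by
    intro y hy
    obtain ⟨z, hz, hxz⟩ := Metric.mem_thickening_iff.1 hx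
    refine one_le_unitTruncation (hu2 y (hδU (Metric.mem_thickening_iff.2 ⟨z, hz, ?_⟩)))
    rw [Metric.mem_ball] at hy
    linarith [dist_triangle y x z]
  have h1 : 1 ≤ truncatedSmoothing μ n u x :=
    (le_median h hr (fun x => unitTruncation_le_one (u x)) hball).trans
      (le_smoothing (median_unitTruncation_nonneg h hr) (median_unitTruncation_le_one h hr) hr x)
  exact EReal.coe_le_coe_iff.2 h1

theorem lipCapacity_le (h : IsDoubling μ cd) (hs0 : 0 < s) (hs1 : s < 1) (hp : 0 < p)
    (hq : 0 < q) {K : Set X} (hK : IsCompact K) :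
    lipCapacity μ s p q K ≤ smoothingConst s p q cd ^ p * besovCapacity μ s p q K := by
  have h0 : smoothingConst s p q cd ^ p ≠ 0 :=
    (ENNReal.rpow_pos (one_pos.trans_le (one_le_smoothingConst s p q cd))
      (smoothingConst_ne_top hs0 hs1 hp hq cd)).ne'
  have ht : smoothingConst s p q cd ^ p ≠ ∞ :=
    ENNReal.rpow_ne_top_of_nonneg hp.le (smoothingConst_ne_top hs0 hs1 hp hq cd)
  rw [besovCapacity, ENNReal.mul_iInf_of_ne h0 ht]
  refine le_iInf fun u => ?_
  rw [ENNReal.mul_iInf_of_ne h0 ht]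
  refine le_iInf fun hu => ?_
  obtain ⟨m, hm⟩ := exists_truncatedSmoothing_mem_lipAdmissible h hs0 hs1 hp hq hK hu
  refine (iInf₂_le _ hm).trans ?_
  rw [← ENNReal.mul_rpow_of_nonneg _ _ hp.le]
  exact ENNReal.rpow_le_rpow (besovNorm_truncatedSmoothing_le h hs0 hs1 hp hq hu.1.1.1 m) hp.le

end Capacity

theorem besovCapacity_le_lipCapacity {X : Type*} [MetricSpace X] [MeasurableSpace X]
    (μ : Measure X) (s p q : ℝ) (K : Set X) :
    besovCapacity μ s p q K ≤ lipCapacity μ s p q K :=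
  biInf_mono fun _ hu => hu.1

end HajlaszBesov

theorem mainTheorem4 (s p q : ℝ) (hs0 : 0 < s) (hs1 : s < 1) (hp : 0 < p) (hq : 0 < q)
    (cd : ℝ≥0) :
    ∃ C : ℝ≥0, 0 < C ∧
      ∀ (X : Type*) [MetricSpace X] [MeasurableSpace X] [BorelSpace X] (μ : Measure X),
        HajlaszBesov.IsDoubling μ cd →
        ∀ K : Set X, IsCompact K →
          (HajlaszBesov.besovCapacity μ s p q K
              ≤ (C : ℝ≥0∞) * HajlaszBesov.lipCapacity μ s p q K) ∧
          (HajlaszBesov.lipCapacity μ s p q K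
              ≤ (C : ℝ≥0∞) * HajlaszBesov.besovCapacity μ s p q K) := by
  have ht : HajlaszBesov.smoothingConst s p q cd ^ p ≠ ∞ :=
    ENNReal.rpow_ne_top_of_nonneg hp.le
      (HajlaszBesov.smoothingConst_ne_top hs0 hs1 hp hq cd)
  have h1 : 1 ≤ HajlaszBesov.smoothingConst s p q cd ^ p :=
    ENNReal.one_le_rpow (HajlaszBesov.one_le_smoothingConst s p q cd) hp
  -- Being at least `1`, the constant of the hard inequality also serves the trivial one.
  refine ⟨(HajlaszBesov.smoothingConst s p q cd ^ p).toNNReal,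
    ENNReal.toNNReal_pos (one_pos.trans_le h1).ne' ht, ?_⟩
  intro X _ _ _ μ h K hK
  rw [ENNReal.coe_toNNReal ht]
  exact ⟨(HajlaszBesov.besovCapacity_le_lipCapacity μ s p q K).trans
    (le_mul_of_one_le_left' h1), HajlaszBesov.lipCapacity_le h hs0 hs1 hp hq hK⟩
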